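/- Fix a constant $j>0$. For a positive Borel measure $\mu$ on $[0,1]$ put $F(r;\mu)=\mu([r,1])$, $r\in[0,1]$, and write $\mu\le\nu$ if $F(r;\mu)\le F(r;\nu)$ for all $r\in[0,1]$; a function $u\in L^\infty([0,1],\mathbb R_+)$ is identified with the measure $u(r)\,dr$. Let $$G^{\rm neum}_t(r,r')=\sum_{k\in\mathbb Z}\big(G_t(r,2k+r')+G_t(r,2k-r')\big),\qquad G_t(r,r')=\frac{e^{-(r-r')^2/2t}}{\sqrt{2\pi t}},$$ be the Neumann heat kernel on $[0,1]$, let $G^{\rm neum}_t*\mu$ be the measure with density $r\mapsto\int G^{\rm neum}_t(r,r')\,\mu(dr')$ on $[0,1]$, and for $\delta>0$ let $$K^{(\delta)}\mu=j\delta D_0+\mathbf 1_{[0,R_\delta(\mu)]}\mu,\qquad R_\delta(\mu)=\inf\{r\in[0,1]:F(r;\mu)=j\delta\},$$ where $D_0$ is the unit mass at $0$. For $u\in L^\infty([0,1],\mathbb R_+)$ with $F(0;u)>0$ and for $\delta>0$ with $j\delta<F(0;u)$ define the lower and upper barriers by $S^{(\delta,\pm)}_0(u)=u$ and, for $n\ge1$,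 $$S^{(\delta,-)}_{n\delta}(u)=K^{(\delta)}\big(G^{\rm neum}_\delta*S^{(\delta,-)}_{(n-1)\delta}(u)\big),\qquad S^{(\delta,+)}_{n\delta}(u)=G^{\rm neum}_\delta*\big(K^{(\delta)}S^{(\delta,+)}_{(n-1)\delta}(u)\big).$$ A function $v(r,t)$, $r\in[0,1]$, $t\ge0$, with $v(\cdot,t)\in L^\infty([0,1],\mathbb R_+)$ for every $t\ge 0$, separates the barriers of $u$ if $$S^{(\delta,-)}_{k\delta}(u)\le v(\cdot,k\delta)\le S^{(\delta,+)}_{k\delta}(u)$$ for all $\delta>0$ with $j\delta<F(0;u)$ and all integers $k\ge0$. **Theorem.** Let $u\in L^\infty([0,1],\mathbb R_+)$ with $F(0;u)=\int_0^1u(r)\,dr>0$. Then there exists a function $\psi(r,t)$, $r\in[0,1]$, $t\ge0$, that separates the barriers of $u$, and it is unique: every function $v$ that separates the barriers of $u$ satisfies, for every $t\ge0$, $v(r,t)=\psi(r,t)$ for almost every $r\in[0,1]$. The function $\psi$ can be chosen continuous on $[0,1]\times(0,\infty)$, and then any separating function that is continuous on $[0,1]\times(0,\infty)$ equals $\psi$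 everywhere on that set. Moreover $\psi(\cdot,t)$ converges weakly to $u$ as $t\to0^+$, i.e. $$\lim_{t\to0^+}\int_0^1\varphi(r)\,\psi(r,t)\,dr=\int_0^1\varphi(r)\,u(r)\,dr\qquad\text{for every continuous }\varphi:[0,1]\to\mathbb R .$$ -/

import Mathlib

open Set MeasureTheory Filter Topology
open scoped ENNReal

noncomputable section

namespace CutPaste

/-- Membership in `L^∞([0,1], ℝ₊)`; only the values on `[0,1]` matter. -/
def IsProfile (u : ℝ → ℝ) : Prop :=
  MemLp u ∞ (volume.restrict (Icc (0 : ℝ) 1)) ∧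
    ∀ᵐ r ∂(volume.restrict (Icc (0 : ℝ) 1)), 0 ≤ u r

/-- The positive Borel measure `u dr` on `[0,1]`, as a measure on `ℝ` supported by `[0,1]`. -/
def profileMeasure (u : ℝ → ℝ) : Measure ℝ :=
  (volume.restrict (Icc (0 : ℝ) 1)).withDensity fun r => ENNReal.ofReal (u r)

/-- `F(r; μ) = μ([r,1])`. -/
def tailMass (r : ℝ) (μ : Measure ℝ) : ℝ≥0∞ := μ (Icc r 1)

/-- The mass transport order: `μ ≤ ν` iff `F(r; μ) ≤ F(r; ν)` for all `r ∈ [0,1]`. -/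
def TransportLE (μ ν : Measure ℝ) : Prop :=
  ∀ r ∈ Icc (0 : ℝ) 1, tailMass r μ ≤ tailMass r ν

/-- The Gaussian kernel `G_t(r, r') = exp(-(r - r')² / 2t) / √(2πt)`. -/
def gaussKernel (t r r' : ℝ) : ℝ :=
  Real.exp (-(r - r') ^ 2 / (2 * t)) / Real.sqrt (2 * Real.pi * t)

/-- The Neumann heat kernel on `[0,1]`, by the method of images: the images of `r'` under
repeated reflections at the end points are `2k + r'` and `2k - r'`, `k ∈ ℤ`. -/
def neumannKernel (t r r' : ℝ) : ℝ :=
  ∑' k : ℤ, (gaussKernel t r (2 * (k : ℝ) + r') + gaussKernel t r (2 * (k : ℝ) - r'))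

/-- `G_t^neum * μ`: the measure on `[0,1]` with density `r ↦ ∫ G_t^neum(r, r') μ(dr')`. -/
def neumannHeat (t : ℝ) (μ : Measure ℝ) : Measure ℝ :=
  (volume.restrict (Icc (0 : ℝ) 1)).withDensity
    fun r => ∫⁻ r', ENNReal.ofReal (neumannKernel t r r') ∂μ

/-- `R_δ(μ) = inf {r ∈ [0,1] : F(r; μ) = jδ}`. -/
def cutPoint (j δ : ℝ) (μ : Measure ℝ) : ℝ :=
  sInf {r : ℝ | r ∈ Icc (0 : ℝ) 1 ∧ tailMass r μ = ENNReal.ofReal (j * δ)}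

/-- The cut-and-paste operator `K^(δ) μ = jδ D₀ + 1_{[0, R_δ(μ)]} μ`. -/
def cutPaste (j δ : ℝ) (μ : Measure ℝ) : Measure ℝ :=
  ENNReal.ofReal (j * δ) • Measure.dirac 0 + μ.restrict (Icc 0 (cutPoint j δ μ))

/-- The lower barrier `S_{nδ}^{(δ,-)}(u)`. -/
def lowerBarrier (j δ : ℝ) (u : ℝ → ℝ) : ℕ → Measure ℝ
  | 0 => profileMeasure u
  | n + 1 => cutPaste j δ (neumannHeat δ (lowerBarrier j δ u n))

/-- The upper barrier `S_{nδ}^{(δ,+)}(u)`. -/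
def upperBarrier (j δ : ℝ) (u : ℝ → ℝ) : ℕ → Measure ℝ
  | 0 => profileMeasure u
  | n + 1 => neumannHeat δ (cutPaste j δ (upperBarrier j δ u n))

/-- `v = v(r,t)`, with `v(·,t) ∈ L^∞([0,1], ℝ₊)` for all `t ≥ 0`, separates the barriers of `u`:
for every `δ > 0` for which the barriers are defined, i.e. `jδ < F(0; u)`, and every `k ∈ ℕ`,
`v(·,kδ)` lies above `S_{kδ}^{(δ,-)}(u)` and below `S_{kδ}^{(δ,+)}(u)`. -/
def Separates (j : ℝ) (u : ℝ → ℝ) (v : ℝ → ℝ → ℝ) : Prop :=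
  (∀ t : ℝ, 0 ≤ t → IsProfile fun r => v r t) ∧
    ∀ δ : ℝ, 0 < δ → ENNReal.ofReal (j * δ) < tailMass 0 (profileMeasure u) →
      ∀ k : ℕ,
        TransportLE (lowerBarrier j δ u k) (profileMeasure fun r => v r (k * δ)) ∧
          TransportLE (profileMeasure fun r => v r (k * δ)) (upperBarrier j δ u k)

end CutPaste

end

/-!
Everything is read off from tail functions. Let `M` be the total mass, `F r = μ [r, 1]`, and
subtract the affine function with the same boundary values, `D r = F r - M (1 - r)`. The deviation
`D` vanishes at `0` and `1`, so it extends to an odd function of period `2` on `ℝ`. Reflecting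
Brownian motion is dual to absorbed Brownian motion, and in these terms the Neumann heat flow of `μ`
is the plain Gaussian average of `D` over `ℝ` (`MassOn.heat`). Cutting and pasting mass `a`
replaces `F` by `max (F - a) 0` on `(0, 1]` and keeps `F 0 = M` (`MassOn.cutPaste`). Both
operations are contractions in the sup norm, and moving mass `a` changes `D` by at most `a`.

Both operations respect the order on `[0, 1]`. For the Gaussian average this is the positivity
`OddPer.gaussAvg_nonneg`: over a short time `τ` the image charges beyond the nearer end point
contribute `O(τ ^ 2)`, and the semigroup property turns this into `n · O((t / n) ^ 2)`. Moreover
cutting after averaging gives less than cutting before averaging (`cut_gaussAvg_le`). Hence merging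
two consecutive time steps raises an upper barrier and lowers a lower one, and every lower barrier
lies below every upper barrier with the same final time, whatever the two partitions
(`lowList_le_upList`). Since `cut` intertwines the two iterations, upper and lower barriers with the
same step `δ` differ by at most `2 j δ` (`abs_upIter_sub_lowIter_le`). The barriers at time `t`
therefore squeeze together onto a limit `evolve`, which is a semigroup in `t`
(`evolve_evolve`); a function separates the barriers exactly when its tails are given by `evolve`,
which is existence and uniqueness.

For regularity, each cut contributes a bounded function, and the Gaussian average over time `s`
makes a function bounded by `c` Lipschitz with constant `c / √s`. Summing over the steps,
`evolve t D` differs from the Gaussian average of `D` by a function with Lipschitz constant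
`2 j √t` (`evolve_sub_gaussAvg_lipschitz`). By the semigroup property `evolve t D` is approximated
in the Lipschitz seminorm, up to `2 j √s`, by the smooth functions
`gaussAvg s (evolve (t - s) D)`. So it is `C¹` in space, with a derivative that is jointly
continuous on positive times, and the density `M - D'` is the required function `solution`.
-/

noncomputable section

namespace CutPaste

open ProbabilityTheory

/-! ### Odd periodic functions and Gaussian averages -/

section OddPeriodic

/-- Odd functions of period `2`, measurable and bounded. They are the odd periodic extensions of
functions on `[0, 1]` that vanish at both end points. -/
structure OddPer (D : ℝ → ℝ) : Prop where
  odd : ∀ y, D (-y) = -D y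
  per : ∀ y, D (y + 2) = D y
  meas : Measurable D
  bdd : ∃ B, ∀ y, |D y| ≤ B

namespace OddPer
variable {D D' : ℝ → ℝ}

theorem per_int (h : OddPer D) (y : ℝ) (k : ℤ) : D (y + 2 * k) = D y := by
  have hp : Function.Periodic D 2 := h.per
  have := hp.int_mul k y
  rwa [mul_comm] at this

theorem zero (h : OddPer D) : D 0 = 0 := by
  have := h.odd 0
  rw [neg_zero] at this
  linarith

theorem one (h : OddPer D) : D 1 = 0 := by
  have h1 := h.odd 1
  have h2 := h.per (-1)
  norm_num at h2
  linarith

theorem reflect_one (h : OddPer D) (y : ℝ) : D (2 - y) = -D y := by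
  rw [← h.odd, ← h.per (-y)]
  congr 1
  ring

theorem sub (h : OddPer D) (h' : OddPer D') : OddPer fun y => D y - D' y where
  odd y := by rw [h.odd, h'.odd]; ring
  per y := by rw [h.per, h'.per]
  meas := h.meas.sub h'.meas
  bdd := by
    obtain ⟨B, hB⟩ := h.bdd
    obtain ⟨B', hB'⟩ := h'.bdd
    exact ⟨B + B', fun y => (abs_sub _ _).trans (add_le_add (hB y) (hB' y))⟩

theorem neg (h : OddPer D) : OddPer fun y => -D y where
  odd y := by rw [h.odd]
  per y := by rw [h.per]
  meas := h.meas.neg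
  bdd := by
    obtain ⟨B, hB⟩ := h.bdd
    exact ⟨B, fun y => by rw [abs_neg]; exact hB y⟩

theorem reflect (h : OddPer D) : OddPer fun y => D (1 - y) where
  odd y := by
    rw [← h.reflect_one]
    congr 1
    ring
  per y := by
    rw [← h.per (1 - (y + 2))]
    congr 1
    ring
  meas := h.meas.comp (measurable_const.sub measurable_id)
  bdd := by
    obtain ⟨B, hB⟩ := h.bdd
    exact ⟨B, fun y => hB _⟩

end OddPer

/-- Reflections and shifts carry every point to `[0, 1]`, with the same sign for all functions in
the class. -/
theorem exists_fold (y : ℝ) : ∃ s ∈ Icc (0 : ℝ) 1, (∀ D, OddPer D → D y = D s) ∨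
    (∀ D, OddPer D → D y = -D s) := by
  set m : ℤ := ⌊(y + 1) / 2⌋
  have h1 : (m : ℝ) ≤ (y + 1) / 2 := Int.floor_le _
  have h2 : (y + 1) / 2 < m + 1 := Int.lt_floor_add_one _
  rcases le_total 0 (y - 2 * m) with h | h
  · refine ⟨y - 2 * m, ⟨h, by linarith⟩, Or.inl fun D hD => ?_⟩
    rw [← hD.per_int (y - 2 * m) m]
    congr 1
    ring
  · refine ⟨-(y - 2 * m), ⟨by linarith, by linarith⟩, Or.inr fun D hD => ?_⟩
    rw [hD.odd, neg_neg, ← hD.per_int (y - 2 * m) m]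
    congr 1
    ring

theorem OddPer.abs_le {D : ℝ → ℝ} (h : OddPer D) {B : ℝ} (hB : ∀ y ∈ Icc (0 : ℝ) 1, |D y| ≤ B)
    (y : ℝ) : |D y| ≤ B := by
  obtain ⟨s, hs, h1 | h1⟩ := exists_fold y
  · rw [h1 D h]; exact hB s hs
  · rw [h1 D h, abs_neg]; exact hB s hs

theorem OddPer.ext01 {D D' : ℝ → ℝ} (h : OddPer D) (h' : OddPer D')
    (he : ∀ y ∈ Icc (0 : ℝ) 1, D y = D' y) : D = D' := by
  funext y
  obtain ⟨s, hs, h1 | h1⟩ := exists_fold y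
  · rw [h1 D h, h1 D' h', he s hs]
  · rw [h1 D h, h1 D' h', he s hs]

/-- A one-sided slope bound on `[0, 1]` extends to `ℝ`: by oddness to `[-1, 1]`, then across periods,
because `D` vanishes at the odd integers. -/
theorem OddPer.slope_of_Icc {D : ℝ → ℝ} (h : OddPer D) {M : ℝ}
    (hs : ∀ y ∈ Icc (0 : ℝ) 1, ∀ y' ∈ Icc (0 : ℝ) 1, y ≤ y' → D y' - D y ≤ M * (y' - y))
    {y y' : ℝ} (hy : y ≤ y') : D y' - D y ≤ M * (y' - y) := by
  have base : ∀ a b : ℝ, -1 ≤ a → a ≤ b → b ≤ 1 → D b - D a ≤ M * (b - a) := by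
    intro a b ha hab hb
    rcases le_total 0 a with h0 | h0
    · exact hs a ⟨h0, hab.trans hb⟩ b ⟨h0.trans hab, hb⟩ hab
    · rcases le_total 0 b with h1 | h1
      · have e1 := hs 0 ⟨le_rfl, zero_le_one⟩ b ⟨h1, hb⟩ h1
        have e2 := hs 0 ⟨le_rfl, zero_le_one⟩ (-a) ⟨by linarith, by linarith⟩ (by linarith)
        rw [h.zero] at e1 e2
        rw [h.odd] at e2
        linarith
      · have e2 := hs (-b) ⟨by linarith, by linarith⟩ (-a) ⟨by linarith, by linarith⟩ (by linarith)
        rw [h.odd, h.odd] at e2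
        linarith
  have h11 : D (-1) = 0 := by rw [h.odd, h.one, neg_zero]
  have red : ∀ x : ℝ, D x = D (x - 2 * (⌊(x + 1) / 2⌋ : ℤ)) := fun x => by
    rw [← h.per_int (x - 2 * (⌊(x + 1) / 2⌋ : ℤ)) ⌊(x + 1) / 2⌋]
    congr 1
    ring
  have lo : ∀ x : ℝ, -1 ≤ x - 2 * (⌊(x + 1) / 2⌋ : ℤ) := fun x => by
    have := Int.floor_le ((x + 1) / 2)
    linarith
  have hi : ∀ x : ℝ, x - 2 * (⌊(x + 1) / 2⌋ : ℤ) ≤ 1 := fun x => by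
    have := Int.lt_floor_add_one ((x + 1) / 2)
    linarith
  have hM : 0 ≤ M := by
    have := hs 0 ⟨le_rfl, zero_le_one⟩ 1 ⟨zero_le_one, le_rfl⟩ zero_le_one
    rw [h.zero, h.one] at this
    linarith
  have hm : ⌊(y + 1) / 2⌋ ≤ ⌊(y' + 1) / 2⌋ := Int.floor_le_floor (by linarith)
  rw [red y, red y']
  rcases hm.eq_or_lt with he | hl
  · have := base (y - 2 * (⌊(y + 1) / 2⌋ : ℤ)) (y' - 2 * (⌊(y' + 1) / 2⌋ : ℤ)) (lo y)
      (by rw [he]; linarith) (hi y')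
    rw [he] at this ⊢
    linarith
  · have e1 := base _ 1 (lo y) (hi y) le_rfl
    have e2 := base (-1) _ le_rfl (lo y') (hi y')
    rw [h.one] at e1
    rw [h11] at e2
    have hl' : ((⌊(y + 1) / 2⌋ : ℤ) : ℝ) + 1 ≤ (⌊(y' + 1) / 2⌋ : ℤ) := by exact_mod_cast hl
    nlinarith

/-- The heat semigroup on `ℝ` with generator half the Laplacian: the average of `D` against the
centred Gaussian law of variance `t`. For `t ≤ 0` the law is the unit mass at `0`. -/
def gaussAvg (t : ℝ) (D : ℝ → ℝ) (y : ℝ) : ℝ := ∫ z, D (y + z) ∂(gaussianReal 0 t.toNNReal)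

section GaussAvg
variable {D D' : ℝ → ℝ} {B : ℝ}

theorem integrable_shift (hD : Measurable D) (hB : ∀ y, |D y| ≤ B) (t y : ℝ) :
    Integrable (fun z => D (y + z)) (gaussianReal 0 t.toNNReal) :=
  Integrable.of_bound (hD.comp (measurable_const.add measurable_id)).aestronglyMeasurable B
    (ae_of_all _ fun _ => hB _)

theorem gaussAvg_abs_le (hB : ∀ y, |D y| ≤ B) (t y : ℝ) : |gaussAvg t D y| ≤ B := by
  have := norm_integral_le_of_norm_le_const (μ := gaussianReal 0 t.toNNReal)
    (f := fun z => D (y + z)) (C := B) (ae_of_all _ fun z => hB _)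
  simpa [gaussAvg] using this

theorem measurable_gaussAvg (hD : Measurable D) (t : ℝ) : Measurable (gaussAvg t D) := by
  have : StronglyMeasurable fun p : ℝ × ℝ => D (p.1 + p.2) :=
    (hD.comp (measurable_fst.add measurable_snd)).stronglyMeasurable
  exact (this.integral_prod_right (ν := gaussianReal 0 t.toNNReal)).measurable

theorem gaussAvg_zero : gaussAvg 0 D = D := by
  funext y
  simp [gaussAvg, gaussianReal_zero_var]

theorem gaussAvg_gaussAvg (hD : Measurable D) (hB : ∀ y, |D y| ≤ B) {s t : ℝ} (hs : 0 ≤ s)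
    (ht : 0 ≤ t) : gaussAvg s (gaussAvg t D) = gaussAvg (s + t) D := by
  funext y
  unfold gaussAvg
  rw [Real.toNNReal_add hs ht]
  have h0 : (0 : ℝ) = 0 + 0 := by ring
  have : gaussianReal 0 (s.toNNReal + t.toNNReal) =
      (gaussianReal 0 s.toNNReal).conv (gaussianReal 0 t.toNNReal) := by
    rw [gaussianReal_conv_gaussianReal, add_zero]
  rw [this, Measure.conv, integral_map, integral_prod]
  · simp only [add_assoc]
  · exact Integrable.of_bound (hD.comp (measurable_const.add
      (measurable_fst.add measurable_snd))).aestronglyMeasurable B (ae_of_all _ fun z => hB _)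
  · exact (measurable_fst.add measurable_snd).aemeasurable
  · exact (hD.comp (measurable_const.add measurable_id)).aestronglyMeasurable

theorem gaussAvg_sub (hD : Measurable D) (hB : ∀ y, |D y| ≤ B) {B' : ℝ} (hD' : Measurable D')
    (hB' : ∀ y, |D' y| ≤ B') (t y : ℝ) :
    gaussAvg t (fun y => D y - D' y) y = gaussAvg t D y - gaussAvg t D' y :=
  integral_sub (integrable_shift hD hB t y) (integrable_shift hD' hB' t y)

theorem integral_gaussianReal_neg (f : ℝ → ℝ) (t : ℝ) :
    ∫ z, f (-z) ∂(gaussianReal 0 t.toNNReal) = ∫ z, f z ∂(gaussianReal 0 t.toNNReal) := by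
  have h : (gaussianReal 0 t.toNNReal).map (fun x ↦ -x) = gaussianReal 0 t.toNNReal := by
    rw [gaussianReal_map_neg, neg_zero]
  conv_rhs => rw [← h]
  exact (integral_map_equiv (MeasurableEquiv.neg ℝ) f).symm

theorem OddPer.gaussAvg (h : OddPer D) (t : ℝ) : OddPer (gaussAvg t D) where
  odd y := by
    have : CutPaste.gaussAvg t D y = ∫ z, D (y + -z) ∂(gaussianReal 0 t.toNNReal) :=
      (integral_gaussianReal_neg (fun z => D (y + z)) t).symm
    rw [this, ← integral_neg]
    refine integral_congr_ae (ae_of_all _ fun z => ?_)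
    show D (-y + z) = - D (y + -z)
    rw [← h.odd]
    congr 1
    ring
  per y := by
    refine integral_congr_ae (ae_of_all _ fun z => ?_)
    show D (y + 2 + z) = D (y + z)
    rw [← h.per (y + z)]
    congr 1
    ring
  meas := measurable_gaussAvg h.meas t
  bdd := by
    obtain ⟨B, hB⟩ := h.bdd
    exact ⟨B, gaussAvg_abs_le hB t⟩

theorem gaussAvg_slope (hD : Measurable D) (hB : ∀ y, |D y| ≤ B) {M : ℝ}
    (hs : ∀ y y', y ≤ y' → D y' - D y ≤ M * (y' - y)) (t : ℝ) {y y' : ℝ} (hy : y ≤ y') :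
    gaussAvg t D y' - gaussAvg t D y ≤ M * (y' - y) := by
  unfold gaussAvg
  rw [← integral_sub (integrable_shift hD hB t y') (integrable_shift hD hB t y)]
  calc _ ≤ ∫ z, M * (y' - y) ∂(gaussianReal 0 t.toNNReal) := by
        refine integral_mono ((integrable_shift hD hB t y').sub (integrable_shift hD hB t y))
          (integrable_const _) fun z => ?_
        have := hs (y + z) (y' + z) (by linarith)
        simpa using this
    _ = _ := by simp

theorem integrable_abs_gaussian (t : ℝ) :
    Integrable (fun z : ℝ => |z|) (gaussianReal 0 t.toNNReal) := by
  have := (memLp_id_gaussianReal (μ := 0) (v := t.toNNReal) 1).integrable (by simp)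
  exact this.abs

theorem integral_sq_gaussian {t : ℝ} (ht : 0 ≤ t) :
    ∫ z, z ^ 2 ∂(gaussianReal 0 t.toNNReal) = t := by
  have h1 := variance_fun_id_gaussianReal (μ := 0) (v := t.toNNReal)
  rw [variance_eq_integral (by fun_prop)] at h1
  simp only [integral_id_gaussianReal, sub_zero] at h1
  rw [h1, Real.coe_toNNReal t ht]

/-- The first absolute moment, bounded through `|z| ≤ z ^ 2 / (2 √t) + √t / 2`. -/
theorem integral_abs_gaussian_le {t : ℝ} (ht : 0 ≤ t) :
    ∫ z, |z| ∂(gaussianReal 0 t.toNNReal) ≤ √t := by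
  have hi : Integrable (fun z : ℝ => z ^ 2) (gaussianReal 0 t.toNNReal) :=
    (memLp_id_gaussianReal (μ := 0) (v := t.toNNReal) 2).integrable_sq
  rcases ht.eq_or_lt with rfl | hp
  · simp [gaussianReal_zero_var]
  have hs : 0 < √t := Real.sqrt_pos.2 hp
  calc ∫ z, |z| ∂(gaussianReal 0 t.toNNReal)
      ≤ ∫ z, (z ^ 2 / (2 * √t) + √t / 2) ∂(gaussianReal 0 t.toNNReal) := by
        refine integral_mono (integrable_abs_gaussian t)
          ((hi.div_const _).add (integrable_const _)) fun z => ?_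
        show |z| ≤ z ^ 2 / (2 * √t) + √t / 2
        rw [div_add_div _ _ (by positivity) (by norm_num), le_div_iff₀ (by positivity)]
        nlinarith [sq_nonneg (|z| - √t), sq_abs z]
    _ = √t := by
        rw [integral_add (hi.div_const _) (integrable_const _), integral_div,
          integral_sq_gaussian ht]
        simp
        field_simp
        rw [Real.sq_sqrt ht]; ring

theorem gaussAvg_sub_self_le (hD : Measurable D) (hB : ∀ y, |D y| ≤ B) {L : ℝ}
    (hL : ∀ y y', |D y - D y'| ≤ L * |y - y'|) {t : ℝ} (ht : 0 ≤ t) (y : ℝ) :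
    |gaussAvg t D y - D y| ≤ L * √t := by
  have hL0 : 0 ≤ L := by
    have := (abs_nonneg _).trans (hL 1 0)
    simpa using this
  have e : gaussAvg t D y - D y = ∫ z, (D (y + z) - D y) ∂(gaussianReal 0 t.toNNReal) := by
    rw [integral_sub (integrable_shift hD hB t y) (integrable_const _)]
    simp [gaussAvg]
  rw [e]
  calc _ ≤ ∫ z, L * |z| ∂(gaussianReal 0 t.toNNReal) := by
        refine (abs_integral_le_integral_abs).trans (integral_mono ?_
          ((integrable_abs_gaussian t).const_mul L) fun z => ?_)
        · exact ((integrable_shift hD hB t y).sub (integrable_const _)).abs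
        · have := hL (y + z) y
          simpa using this
    _ ≤ L * √t := by
        rw [integral_const_mul]
        exact mul_le_mul_of_nonneg_left (integral_abs_gaussian_le ht) hL0

end GaussAvg

end OddPeriodic

/-! ### Positivity and smoothing of the Gaussian average -/

section Smoothing

section Positivity
variable {D : ℝ → ℝ} {B : ℝ}

theorem toNNReal_ne_zero {t : ℝ} (ht : 0 < t) : t.toNNReal ≠ 0 := by
  simpa using ht

theorem gaussAvg_eq_integral_pdf (D : ℝ → ℝ) {t : ℝ} (ht : 0 < t) (y : ℝ) :
    gaussAvg t D y = ∫ x, D x * gaussianPDFReal y t.toNNReal x := by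
  unfold gaussAvg
  rw [integral_gaussianReal_eq_integral_smul (toNNReal_ne_zero ht),
    ← integral_sub_right_eq_self _ y]
  refine integral_congr_ae (ae_of_all _ fun x => ?_)
  show gaussianPDFReal 0 t.toNNReal (x - y) • D (y + (x - y)) = _
  rw [gaussianPDFReal_sub, zero_add, smul_eq_mul, mul_comm]
  congr 2
  ring

theorem gaussianPDFReal_neg_arg (v : NNReal) (x y : ℝ) :
    gaussianPDFReal y v (-x) = gaussianPDFReal (-y) v x := by
  simp only [gaussianPDFReal]
  congr 3
  ring

theorem gaussianPDFReal_mono_reflect (v : NNReal) {x y : ℝ} (hx : 0 ≤ x) (hy : 0 ≤ y) :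
    gaussianPDFReal (-y) v x ≤ gaussianPDFReal y v x := by
  simp only [gaussianPDFReal]
  have : -(x - -y) ^ 2 ≤ -(x - y) ^ 2 := by nlinarith [mul_nonneg hx hy]
  gcongr

/-- On the half line the Dirichlet kernel is the difference of two Gaussian densities, which is
nonnegative; hence averaging an odd function keeps a lower bound `-ε` on `[0, ∞)`. -/
theorem gaussAvg_odd_ge (hD : Measurable D) (hB : ∀ y, |D y| ≤ B) (hodd : ∀ y, D (-y) = -D y)
    {ε : ℝ} (hε : 0 ≤ ε) (hpos : ∀ x, 0 ≤ x → -ε ≤ D x) {t : ℝ} (ht : 0 < t) {y : ℝ}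
    (hy : 0 ≤ y) : -ε ≤ gaussAvg t D y := by
  set v := t.toNNReal
  have hv : v ≠ 0 := toNNReal_ne_zero ht
  have hi : ∀ m, Integrable (fun x => D x * gaussianPDFReal m v x) := fun m =>
    (integrable_gaussianPDFReal m v).bdd_mul hD.aestronglyMeasurable (ae_of_all _ hB)
  have e1 : gaussAvg t D y = ∫ x, D x * gaussianPDFReal y v x := gaussAvg_eq_integral_pdf D ht y
  have e2 : gaussAvg t D y = -∫ x, D x * gaussianPDFReal (-y) v x := by
    rw [e1, ← integral_neg_eq_self, ← integral_neg]
    refine integral_congr_ae (ae_of_all _ fun x => ?_)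
    show D (-x) * gaussianPDFReal y v (-x) = -(D x * gaussianPDFReal (-y) v x)
    rw [hodd, gaussianPDFReal_neg_arg]
    ring
  have key : ∫ x, (-ε) * (gaussianPDFReal y v x + gaussianPDFReal (-y) v x) ≤
      ∫ x, (D x * gaussianPDFReal y v x - D x * gaussianPDFReal (-y) v x) := by
    refine integral_mono (((integrable_gaussianPDFReal _ v).add
      (integrable_gaussianPDFReal _ v)).const_mul _) ((hi y).sub (hi (-y))) fun x => ?_
    show (-ε) * (gaussianPDFReal y v x + gaussianPDFReal (-y) v x) ≤
      D x * gaussianPDFReal y v x - D x * gaussianPDFReal (-y) v x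
    have p1 := gaussianPDFReal_nonneg y v x
    have p2 := gaussianPDFReal_nonneg (-y) v x
    rcases le_total 0 x with hx | hx
    · have h1 := hpos x hx
      have h2 := gaussianPDFReal_mono_reflect v hx hy
      nlinarith
    · have h1 := hpos (-x) (by linarith)
      rw [hodd] at h1
      have h2 := gaussianPDFReal_mono_reflect v (x := -x) (by linarith) hy
      rw [gaussianPDFReal_neg_arg, gaussianPDFReal_neg_arg, neg_neg] at h2
      nlinarith
  rw [integral_sub (hi y) (hi (-y)), integral_const_mul,
    integral_add (integrable_gaussianPDFReal _ v) (integrable_gaussianPDFReal _ v),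
    integral_gaussianPDFReal_eq_one _ hv, integral_gaussianPDFReal_eq_one _ hv] at key
  linarith

theorem integrable_pow_four_gaussian (v : NNReal) :
    Integrable (fun z : ℝ => z ^ 4) (gaussianReal 0 v) := by
  have h := (memLp_id_gaussianReal (μ := 0) (v := v) 4).integrable_norm_pow (by norm_num)
  refine h.congr (ae_of_all _ fun z => ?_)
  show ‖id z‖ ^ 4 = z ^ 4
  rw [id, Real.norm_eq_abs, Even.pow_abs ⟨2, rfl⟩]

theorem integral_pow_four_gaussian {t : ℝ} (ht : 0 ≤ t) :
    ∫ z, z ^ 4 ∂(gaussianReal 0 t.toNNReal) = t ^ 2 * ∫ z, z ^ 4 ∂(gaussianReal 0 1) := by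
  have h := gaussianReal_map_const_mul (μ := 0) (v := 1) (√t)
  have e : gaussianReal 0 t.toNNReal = (gaussianReal 0 1).map (√t * ·) := by
    rw [h]
    congr 1
    · simp
    · ext
      simp [Real.sq_sqrt ht, ht]
  rw [e, integral_map (by fun_prop) (by fun_prop), ← integral_const_mul]
  refine integral_congr_ae (ae_of_all _ fun z => ?_)
  show (√t * z) ^ 4 = t ^ 2 * z ^ 4
  have : √t ^ 4 = t ^ 2 := by
    rw [show √t ^ 4 = (√t ^ 2) ^ 2 by ring, Real.sq_sqrt ht]
  rw [mul_pow, this]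

/-- Positivity near the end point `0` over a short time: `D` is compared with the odd function
`D · 1_{[-1, 1]}`. From a point of `[0, 1/2]` the two differ only after a displacement of at least
`1/2`, whose probability is controlled by the fourth moment. -/
theorem OddPer.gaussAvg_ge_left (h : OddPer D) (hB : ∀ y, |D y| ≤ B) {ε : ℝ} (hε : 0 ≤ ε)
    (hpos : ∀ x ∈ Icc (0 : ℝ) 1, -ε ≤ D x) {t : ℝ} (ht : 0 < t) {y : ℝ}
    (hy : 0 ≤ y) (hy' : y ≤ 1 / 2) :
    -ε - 16 * B * (t ^ 2 * ∫ z, z ^ 4 ∂(gaussianReal 0 1)) ≤ CutPaste.gaussAvg t D y := by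
  have hB0 : 0 ≤ B := (abs_nonneg _).trans (hB 0)
  set D0 : ℝ → ℝ := (Icc (-1 : ℝ) 1).indicator D with hD0
  have m0 : Measurable D0 := h.meas.indicator measurableSet_Icc
  have b0 : ∀ y, |D0 y| ≤ B := fun y => by
    by_cases hy : y ∈ Icc (-1 : ℝ) 1
    · rw [hD0, indicator_of_mem hy]; exact hB y
    · rw [hD0, indicator_of_notMem hy, abs_zero]; exact hB0
  have o0 : ∀ y, D0 (-y) = -D0 y := fun y => by
    by_cases hy : y ∈ Icc (-1 : ℝ) 1
    · have hy2 : -y ∈ Icc (-1 : ℝ) 1 := ⟨by linarith [hy.2], by linarith [hy.1]⟩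
      rw [hD0, indicator_of_mem hy, indicator_of_mem hy2, h.odd]
    · have hy2 : -y ∉ Icc (-1 : ℝ) 1 := fun h2 => hy ⟨by linarith [h2.2], by linarith [h2.1]⟩
      rw [hD0, indicator_of_notMem hy, indicator_of_notMem hy2, neg_zero]
  have p0 : ∀ x, 0 ≤ x → -ε ≤ D0 x := fun x hx => by
    by_cases hy : x ∈ Icc (-1 : ℝ) 1
    · rw [hD0, indicator_of_mem hy]; exact hpos x ⟨hx, hy.2⟩
    · rw [hD0, indicator_of_notMem hy]; linarith
  have h1 := gaussAvg_odd_ge m0 b0 o0 hε p0 ht hy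
  have h2 : CutPaste.gaussAvg t D0 y - CutPaste.gaussAvg t D y ≤
      ∫ z, 16 * B * z ^ 4 ∂(gaussianReal 0 t.toNNReal) := by
    unfold CutPaste.gaussAvg
    rw [← integral_sub (integrable_shift m0 b0 t y) (integrable_shift h.meas hB t y)]
    refine integral_mono ((integrable_shift m0 b0 t y).sub (integrable_shift h.meas hB t y))
      ((integrable_pow_four_gaussian _).const_mul _) fun z => ?_
    show D0 (y + z) - D (y + z) ≤ 16 * B * z ^ 4
    have hz4 : 0 ≤ z ^ 4 := by positivity
    by_cases hz : y + z ∈ Icc (-1 : ℝ) 1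
    · rw [hD0, indicator_of_mem hz]
      have : 0 ≤ 16 * B * z ^ 4 := by positivity
      linarith
    · rw [hD0, indicator_of_notMem hz]
      have hz2 : 1 / 4 ≤ z ^ 2 := by
        by_contra hc
        push Not at hc
        have := abs_lt_of_sq_lt_sq (a := z) (b := 1 / 2) (by linarith) (by norm_num)
        rw [abs_lt] at this
        exact hz ⟨by linarith, by linarith⟩
      have hz3 : 1 ≤ 16 * z ^ 4 := by nlinarith
      have := neg_le_of_abs_le (hB (y + z))
      nlinarith
  rw [integral_const_mul, integral_pow_four_gaussian ht.le] at h2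
  linarith

/-- The short time lower bound on all of `[0, 1]`; the half next to `1` is reflected onto the half next
to `0`. -/
theorem OddPer.gaussAvg_ge (h : OddPer D) (hB : ∀ y, |D y| ≤ B) {ε : ℝ} (hε : 0 ≤ ε)
    (hpos : ∀ x ∈ Icc (0 : ℝ) 1, -ε ≤ D x) {t : ℝ} (ht : 0 < t) {y : ℝ}
    (hy : y ∈ Icc (0 : ℝ) 1) :
    -ε - 16 * B * (t ^ 2 * ∫ z, z ^ 4 ∂(gaussianReal 0 1)) ≤ CutPaste.gaussAvg t D y := by
  rcases le_total y (1 / 2) with hy' | hy'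
  · exact h.gaussAvg_ge_left hB hε hpos ht hy.1 hy'
  · have := h.reflect.gaussAvg_ge_left (fun y => hB _) hε
      (fun x hx => hpos (1 - x) ⟨by linarith [hx.2], by linarith [hx.1]⟩) ht (y := 1 - y)
      (by linarith [hy.2]) (by linarith)
    refine this.trans_eq ?_
    unfold CutPaste.gaussAvg
    rw [← integral_gaussianReal_neg]
    refine integral_congr_ae (ae_of_all _ fun z => ?_)
    show D (1 - (1 - y + -z)) = D (y + z)
    congr 1
    ring

/-- Positivity of the Dirichlet heat semigroup on `[0, 1]`. The error of one step of length `t / n` is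
`O((t / n) ^ 2)`, so `n` steps cost `O(1 / n)`. -/
theorem OddPer.gaussAvg_nonneg (h : OddPer D) (hpos : ∀ x ∈ Icc (0 : ℝ) 1, 0 ≤ D x) {t : ℝ}
    (ht : 0 ≤ t) {y : ℝ} (hy : y ∈ Icc (0 : ℝ) 1) : 0 ≤ CutPaste.gaussAvg t D y := by
  rcases ht.eq_or_lt with rfl | ht
  · rw [gaussAvg_zero]; exact hpos y hy
  obtain ⟨B, hB⟩ := h.bdd
  have hB0 : 0 ≤ B := (abs_nonneg _).trans (hB 0)
  set C := 16 * B * ∫ z, z ^ 4 ∂(gaussianReal 0 1) with hC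
  have hC0 : 0 ≤ C := by
    have : 0 ≤ ∫ z, z ^ 4 ∂(gaussianReal 0 1) := integral_nonneg fun z => by positivity
    positivity
  have step : ∀ τ : ℝ, 0 < τ → ∀ n : ℕ, ∀ x ∈ Icc (0 : ℝ) 1,
      -(n * (C * τ ^ 2)) ≤ CutPaste.gaussAvg (n * τ) D x := by
    intro τ hτ n
    induction n with
    | zero => intro x hx; simpa [gaussAvg_zero] using hpos x hx
    | succ n ih =>
      intro x hx
      have := (h.gaussAvg (n * τ)).gaussAvg_ge (gaussAvg_abs_le hB _) (by positivity) ih hτ hx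
      rw [gaussAvg_gaussAvg h.meas hB hτ.le (by positivity)] at this
      have e : ((n + 1 : ℕ) : ℝ) * τ = τ + n * τ := by push_cast; ring
      rw [e]
      refine le_trans (le_of_eq ?_) this
      rw [hC]; push_cast; ring
  have lim : Tendsto (fun n : ℕ => -(C * t ^ 2) * (1 / ((n : ℝ) + 1))) atTop (𝓝 0) := by
    simpa using tendsto_one_div_add_atTop_nhds_zero_nat.const_mul (-(C * t ^ 2))
  refine le_of_tendsto' lim fun n => ?_
  have hn : (0 : ℝ) < (n : ℝ) + 1 := by positivity
  have := step (t / (n + 1)) (by positivity) (n + 1) y hy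
  push_cast at this
  rw [mul_div_cancel₀ _ hn.ne'] at this
  refine le_trans (le_of_eq ?_) this
  field_simp

end Positivity

section Gradient
variable {D : ℝ → ℝ} {B : ℝ}

/-- The spatial derivative of `gaussAvg t D`, with the derivative put on the Gaussian density. -/
def gaussGrad (t : ℝ) (D : ℝ → ℝ) (y : ℝ) : ℝ :=
  ∫ z, D (y + z) * (z / t) ∂(gaussianReal 0 t.toNNReal)

theorem gaussGrad_eq_integral_pdf (D : ℝ → ℝ) {t : ℝ} (ht : 0 < t) (y : ℝ) :
    gaussGrad t D y = ∫ x, D x * (gaussianPDFReal y t.toNNReal x * ((x - y) / t)) := by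
  unfold gaussGrad
  rw [integral_gaussianReal_eq_integral_smul (toNNReal_ne_zero ht),
    ← integral_sub_right_eq_self _ y]
  refine integral_congr_ae (ae_of_all _ fun x => ?_)
  show gaussianPDFReal 0 t.toNNReal (x - y) • (D (y + (x - y)) * ((x - y) / t)) = _
  rw [gaussianPDFReal_sub, zero_add, smul_eq_mul, add_sub_cancel]
  ring

theorem hasDerivAt_gaussianPDFReal {t : ℝ} (ht : 0 < t) (x y : ℝ) :
    HasDerivAt (fun y => gaussianPDFReal y t.toNNReal x)
      (gaussianPDFReal y t.toNNReal x * ((x - y) / t)) y := by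
  simp only [gaussianPDFReal, Real.coe_toNNReal t ht.le]
  have h1 : HasDerivAt (fun y : ℝ => -(x - y) ^ 2 / (2 * t)) ((x - y) / t) y := by
    have := ((((hasDerivAt_id y).const_sub x).pow 2).neg).div_const (2 * t)
    have e : (x - y) / t = -(((2 : ℕ) : ℝ) * (x - id y) ^ (2 - 1) * -1) / (2 * t) := by
      simp only [id]
      field_simp
      norm_num
      ring
    rw [e]
    exact this
  have := h1.exp.const_mul (√(2 * Real.pi * t))⁻¹
  rw [← mul_assoc] at this
  exact this

theorem hasDerivAt_gaussAvg (hD : Measurable D) (hB : ∀ y, |D y| ≤ B) {t : ℝ} (ht : 0 < t)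
    (y₀ : ℝ) : HasDerivAt (gaussAvg t D) (gaussGrad t D y₀) y₀ := by
  have hB0 : 0 ≤ B := (abs_nonneg _).trans (hB 0)
  have hb : 0 < 1 / (4 * t) := by positivity
  set c : ℝ := B * ((√(2 * Real.pi * t))⁻¹ * Real.exp (1 / (2 * t)) / t) with hc
  have hi : Integrable fun x : ℝ => c * (‖(x - y₀) * Real.exp (-(1 / (4 * t)) * (x - y₀) ^ 2)‖ +
      Real.exp (-(1 / (4 * t)) * (x - y₀) ^ 2)) :=
    (((integrable_mul_exp_neg_mul_sq hb).norm.comp_sub_right y₀).add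
      ((integrable_exp_neg_mul_sq hb).comp_sub_right y₀)).const_mul c
  have hpdf : ∀ m, Integrable (fun x => D x * gaussianPDFReal m t.toNNReal x) := fun m =>
    (integrable_gaussianPDFReal m _).bdd_mul hD.aestronglyMeasurable (ae_of_all _ hB)
  have key := hasDerivAt_integral_of_dominated_loc_of_deriv_le (μ := volume)
    (F := fun y x => D x * gaussianPDFReal y t.toNNReal x)
    (F' := fun y x => D x * (gaussianPDFReal y t.toNNReal x * ((x - y) / t)))
    (Metric.ball_mem_nhds y₀ one_pos)
    (.of_forall fun m => (hpdf m).aestronglyMeasurable) (hpdf y₀)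
    (hD.mul ((measurable_gaussianPDFReal _ _).mul (by fun_prop))).aestronglyMeasurable
    (ae_of_all _ fun x y hy => ?_) hi
    (ae_of_all _ fun x y _ => (hasDerivAt_gaussianPDFReal ht x y).const_mul (D x))
  · have e1 : (fun y => ∫ x, D x * gaussianPDFReal y t.toNNReal x) = gaussAvg t D := by
      funext y
      rw [gaussAvg_eq_integral_pdf D ht]
    rw [gaussGrad_eq_integral_pdf D ht, ← e1]
    exact key.2
  · rw [Metric.mem_ball, Real.dist_eq] at hy
    simp only [gaussianPDFReal, Real.coe_toNNReal t ht.le, norm_mul, norm_div, Real.norm_eq_abs,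
      Real.abs_exp, abs_of_pos ht]
    rw [abs_of_nonneg (by positivity : 0 ≤ (√(2 * Real.pi * t))⁻¹)]
    have hxy : |x - y| ≤ |x - y₀| + 1 := by
      have : x - y = (x - y₀) - (y - y₀) := by ring
      rw [this]
      exact (abs_sub _ _).trans (by linarith)
    -- `(x - y₀) ^ 2 ≤ 2 (x - y) ^ 2 + 2` halves the rate in the exponent, uniformly in `y`
    have hexp : Real.exp (-(x - y) ^ 2 / (2 * t)) ≤
        Real.exp (1 / (2 * t)) * Real.exp (-(1 / (4 * t)) * (x - y₀) ^ 2) := by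
      rw [← Real.exp_add, Real.exp_le_exp]
      have h1 : (x - y₀) ^ 2 ≤ 2 * (x - y) ^ 2 + 2 := by
        have h2 : (y - y₀) ^ 2 ≤ 1 := by
          rw [← sq_abs]; nlinarith [abs_nonneg (y - y₀)]
        nlinarith [sq_nonneg ((x - y) - (y - y₀))]
      have e : 1 / (2 * t) + -(1 / (4 * t)) * (x - y₀) ^ 2 - -(x - y) ^ 2 / (2 * t) =
        (2 * (x - y) ^ 2 + 2 - (x - y₀) ^ 2) / (4 * t) := by field_simp; ring
      have : 0 ≤ (2 * (x - y) ^ 2 + 2 - (x - y₀) ^ 2) / (4 * t) :=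
        div_nonneg (by linarith) (by positivity)
      linarith
    calc |D x| * ((√(2 * Real.pi * t))⁻¹ * Real.exp (-(x - y) ^ 2 / (2 * t)) * (|x - y| / t))
        ≤ B * ((√(2 * Real.pi * t))⁻¹ * (Real.exp (1 / (2 * t)) *
          Real.exp (-(1 / (4 * t)) * (x - y₀) ^ 2)) * ((|x - y₀| + 1) / t)) := by
          gcongr
          exact hB x
      _ = _ := by rw [hc]; ring

theorem abs_gaussGrad_le (hB : ∀ y, |D y| ≤ B) {t : ℝ} (ht : 0 < t) (y : ℝ) :
    |gaussGrad t D y| ≤ B / √t := by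
  have hB0 : 0 ≤ B := (abs_nonneg _).trans (hB 0)
  have hs : 0 < √t := Real.sqrt_pos.2 ht
  calc |gaussGrad t D y| ≤ ∫ z, (B / t) * |z| ∂(gaussianReal 0 t.toNNReal) := by
        rw [gaussGrad, ← Real.norm_eq_abs]
        refine norm_integral_le_of_norm_le ((integrable_abs_gaussian t).const_mul _)
          (ae_of_all _ fun z => ?_)
        rw [norm_mul, norm_div, Real.norm_eq_abs, Real.norm_eq_abs, Real.norm_eq_abs,
          abs_of_pos ht]
        calc |D (y + z)| * (|z| / t) ≤ B * (|z| / t) := by gcongr; exact hB _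
          _ = _ := by ring
    _ ≤ (B / t) * √t := by
        rw [integral_const_mul]
        exact mul_le_mul_of_nonneg_left (integral_abs_gaussian_le ht.le) (by positivity)
    _ = B / √t := by
        nth_rewrite 1 [← Real.sq_sqrt ht.le]
        field_simp

/-- Smoothing: a bounded function becomes Lipschitz with constant of order `1 / √t`. -/
theorem gaussAvg_lipschitz (hD : Measurable D) (hB : ∀ y, |D y| ≤ B) {t : ℝ} (ht : 0 < t)
    (y y' : ℝ) : |gaussAvg t D y - gaussAvg t D y'| ≤ B / √t * |y - y'| := by
  have := Convex.norm_image_sub_le_of_norm_hasDerivWithin_le (𝕜 := ℝ) (f := gaussAvg t D)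
    (s := univ) (C := B / √t) (x := y') (y := y)
    (fun x _ => (hasDerivAt_gaussAvg hD hB ht x).hasDerivWithinAt)
    (fun x _ => abs_gaussGrad_le hB ht x) convex_univ (mem_univ y') (mem_univ y)
  simpa using this

theorem integrable_shift_mul (hD : Measurable D) (hB : ∀ y, |D y| ≤ B) (t y : ℝ) :
    Integrable (fun z => D (y + z) * (z / t)) (gaussianReal 0 t.toNNReal) := by
  have h : Integrable (fun z : ℝ => z / t) (gaussianReal 0 t.toNNReal) :=
    ((memLp_id_gaussianReal (μ := 0) (v := t.toNNReal) 1).integrable (by simp)).div_const t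
  exact h.bdd_mul (hD.comp (measurable_const.add measurable_id)).aestronglyMeasurable
    (ae_of_all _ fun z => hB _)

theorem abs_gaussGrad_sub_le {D' : ℝ → ℝ} {B' : ℝ} (hD : Measurable D) (hB : ∀ y, |D y| ≤ B)
    (hD' : Measurable D') (hB' : ∀ y, |D' y| ≤ B') {t c : ℝ} (ht : 0 < t) (y y' : ℝ)
    (hc : ∀ z, |D (y + z) - D' (y' + z)| ≤ c) :
    |gaussGrad t D y - gaussGrad t D' y'| ≤ c / √t := by
  have e : gaussGrad t D y - gaussGrad t D' y' =
      gaussGrad t (fun z => D (y + z) - D' (y' + z)) 0 := by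
    unfold gaussGrad
    rw [← integral_sub (integrable_shift_mul hD hB t y) (integrable_shift_mul hD' hB' t y')]
    refine integral_congr_ae (ae_of_all _ fun z => ?_)
    simp only [zero_add]
    ring
  rw [e]
  exact abs_gaussGrad_le hc ht 0

theorem gaussGrad_gaussAvg (hD : Measurable D) (hB : ∀ y, |D y| ≤ B) {s t : ℝ} (hs : 0 < s)
    (ht : 0 < t) : gaussGrad s (gaussAvg t D) = gaussGrad (s + t) D := by
  funext y
  have h1 := hasDerivAt_gaussAvg (measurable_gaussAvg hD t) (gaussAvg_abs_le hB t) hs y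
  rw [gaussAvg_gaussAvg hD hB hs.le ht.le] at h1
  exact h1.unique (hasDerivAt_gaussAvg hD hB (add_pos hs ht) y)

/-- The gradient is Lipschitz: half of the time makes the average Lipschitz, the other half is spent on
the derivative. -/
theorem gaussGrad_lipschitz (hD : Measurable D) (hB : ∀ y, |D y| ≤ B) {t : ℝ} (ht : 0 < t)
    (y y' : ℝ) : |gaussGrad t D y - gaussGrad t D y'| ≤ 2 * B / t * |y - y'| := by
  have ht2 : 0 < t / 2 := by positivity
  have hs : √(t / 2) * √(t / 2) = t / 2 := Real.mul_self_sqrt ht2.le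
  have hs0 : 0 < √(t / 2) := Real.sqrt_pos.2 ht2
  have e : gaussGrad t D = gaussGrad (t / 2) (gaussAvg (t / 2) D) := by
    rw [gaussGrad_gaussAvg hD hB ht2 ht2, add_halves]
  rw [e]
  have := abs_gaussGrad_sub_le (measurable_gaussAvg hD (t / 2)) (gaussAvg_abs_le hB (t / 2))
    (measurable_gaussAvg hD (t / 2)) (gaussAvg_abs_le hB (t / 2)) ht2 y y'
    (c := B / √(t / 2) * |y - y'|) (fun z => by
      have := gaussAvg_lipschitz hD hB ht2 (y + z) (y' + z)
      simpa using this)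
  refine this.trans_eq ?_
  rw [div_mul_eq_mul_div, div_div, hs]
  field_simp

end Gradient

end Smoothing

/-! ### Deviations of tail functions and the barrier steps -/

section Deviations

/-- Deviations `D y = F y - M (1 - y)` of tail functions `F` of positive measures of mass `M`. The
condition `slope` says that `F` is nonincreasing. -/
structure State (M : ℝ) (D : ℝ → ℝ) : Prop extends OddPer D where
  slope : ∀ y y', y ≤ y' → D y' - D y ≤ M * (y' - y)

section OddExt

/-- The odd extension of period `2` of the restriction of `f` to the open interval `(0, 1)`. Both
summands are periodic, and `y ↦ -y` exchanges them; the first carries `(0, 1)`, the second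
`(-1, 0)`, and they cancel at the even integers. -/
def oddExt (f : ℝ → ℝ) (y : ℝ) : ℝ :=
  (if 2 * Int.fract (y / 2) < 1 then f (2 * Int.fract (y / 2)) else 0) -
    (if 2 * Int.fract (-y / 2) < 1 then f (2 * Int.fract (-y / 2)) else 0)

variable {f : ℝ → ℝ} {B : ℝ}

theorem oddExt_of_mem_Ioo (f : ℝ → ℝ) {y : ℝ} (hy : y ∈ Ioo (0 : ℝ) 1) : oddExt f y = f y := by
  have h1 : Int.fract (y / 2) = y / 2 :=
    Int.fract_eq_self.2 ⟨by linarith [hy.1], by linarith [hy.2]⟩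
  have h2 : Int.fract (-y / 2) = 1 - y / 2 := by
    rw [Int.fract_eq_iff]
    refine ⟨by linarith [hy.2], by linarith [hy.1], -1, ?_⟩
    push_cast
    ring
  unfold oddExt
  rw [h1, h2, if_pos (by linarith [hy.2]), if_neg (by linarith [hy.2]), sub_zero]
  congr 1
  ring

theorem OddPer.oddExt (hf : Measurable f) (hB : ∀ y ∈ Icc (0 : ℝ) 1, |f y| ≤ B) :
    OddPer (oddExt f) where
  odd y := by
    simp only [CutPaste.oddExt, neg_neg, neg_sub]
  per y := by
    have h1 : Int.fract ((y + 2) / 2) = Int.fract (y / 2) := by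
      rw [show (y + 2) / 2 = y / 2 + 1 by ring, Int.fract_add_one]
    have h2 : Int.fract (-(y + 2) / 2) = Int.fract (-y / 2) := by
      rw [show -(y + 2) / 2 = -y / 2 - 1 by ring, Int.fract_sub_one]
    simp only [CutPaste.oddExt, h1, h2]
  meas := by
    have h : Measurable fun c : ℝ => if 2 * c < 1 then f (2 * c) else 0 :=
      Measurable.ite (measurableSet_lt (measurable_id.const_mul 2) measurable_const)
        (hf.comp (measurable_id.const_mul 2)) measurable_const
    exact (h.comp (measurable_fract.comp (measurable_id.div_const 2))).sub
      (h.comp (measurable_fract.comp (measurable_id.neg.div_const 2)))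
  bdd := by
    have hB0 : 0 ≤ B := (abs_nonneg _).trans (hB 0 ⟨le_rfl, zero_le_one⟩)
    have h : ∀ x : ℝ, |if 2 * Int.fract x < 1 then f (2 * Int.fract x) else 0| ≤ B := fun x => by
      split_ifs with h
      · exact hB _ ⟨by have := Int.fract_nonneg x; linarith, h.le⟩
      · rwa [abs_zero]
    exact ⟨B + B, fun y => (abs_sub _ _).trans (add_le_add (h _) (h _))⟩

end OddExt

variable {M a b c j δ : ℝ} {D D' : ℝ → ℝ}

namespace State

theorem mass_nonneg (h : State M D) : 0 ≤ M := by
  have := h.slope 0 1 zero_le_one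
  rw [h.zero, h.one] at this
  linarith

theorem tail_le (h : State M D) {y : ℝ} (hy : 0 ≤ y) : D y + M * (1 - y) ≤ M := by
  have := h.slope 0 y hy
  rw [h.zero] at this
  linarith

theorem tail_nonneg (h : State M D) {y : ℝ} (hy : y ≤ 1) : 0 ≤ D y + M * (1 - y) := by
  have := h.slope y 1 hy
  rw [h.one] at this
  linarith

theorem abs_le (h : State M D) (y : ℝ) : |D y| ≤ M := by
  have hM := h.mass_nonneg
  refine h.toOddPer.abs_le (fun y hy => ?_) y
  have h1 := h.tail_le hy.1
  have h2 := h.tail_nonneg hy.2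
  have h3 : M * y ≤ M := by nlinarith [hy.2]
  have h4 : 0 ≤ M * y := mul_nonneg hM hy.1
  rw [_root_.abs_le]
  constructor <;> linarith

theorem gaussAvg (h : State M D) (t : ℝ) : State M (gaussAvg t D) where
  toOddPer := h.toOddPer.gaussAvg t
  slope _ _ hy := gaussAvg_slope h.meas h.abs_le h.slope t hy

theorem of_tendsto {u : ℕ → ℝ → ℝ} (hu : ∀ n, State M (u n))
    (hlim : ∀ y, Tendsto (fun n => u n y) atTop (𝓝 (D y))) : State M D where
  odd y := tendsto_nhds_unique (hlim (-y)) (by simpa only [(hu _).odd] using (hlim y).neg)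
  per y := tendsto_nhds_unique (hlim (y + 2)) (by simpa only [(hu _).per] using hlim y)
  meas := measurable_of_tendsto_metrizable (fun n => (hu n).meas) (tendsto_pi_nhds.2 hlim)
  bdd := ⟨M, fun y => le_of_tendsto' (hlim y).abs fun n => (hu n).abs_le y⟩
  slope y y' hy := le_of_tendsto' ((hlim y').sub (hlim y)) fun n => (hu n).slope y y' hy

end State

/-- Cut and paste of mass `a` in terms of deviations: the tail function loses `min F a` on `(0, 1)`,
while its value `M` at `0` stays. -/
def cut (M a : ℝ) (D : ℝ → ℝ) (y : ℝ) : ℝ :=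
  D y - oddExt (fun r => min (D r + M * (1 - r)) a) y

section Cut

theorem OddPer.oddExt_min (h : State M D) (ha : 0 ≤ a) :
    OddPer (CutPaste.oddExt fun r => min (D r + M * (1 - r)) a) :=
  OddPer.oddExt (B := a) ((h.meas.add ((measurable_const.sub measurable_id).const_mul M)).min
    measurable_const) fun y hy => by
      rw [abs_of_nonneg (le_min (h.tail_nonneg hy.2) ha)]
      exact min_le_right _ _

theorem OddPer.cut (h : State M D) (ha : 0 ≤ a) : OddPer (cut M a D) :=
  h.toOddPer.sub (OddPer.oddExt_min h ha)

theorem tail_cut (h : State M D) (ha : 0 ≤ a) {y : ℝ} (hy : y ∈ Ioc (0 : ℝ) 1) :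
    cut M a D y + M * (1 - y) = max (D y + M * (1 - y) - a) 0 := by
  rcases hy.2.eq_or_lt with rfl | h1
  · rw [(OddPer.cut h ha).one, h.one]
    simp [ha]
  · rw [cut, oddExt_of_mem_Ioo _ ⟨hy.1, h1⟩]
    rcases le_total (D y + M * (1 - y)) a with hl | hl
    · rw [min_eq_left hl, max_eq_right (by linarith)]
      ring
    · rw [min_eq_right hl, max_eq_left (by linarith)]
      ring

theorem State.cut (h : State M D) (ha : 0 ≤ a) : State M (cut M a D) where
  toOddPer := OddPer.cut h ha
  slope _ _ hyy := by
    refine (OddPer.cut h ha).slope_of_Icc (fun y hy y' hy' hle => ?_) hyy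
    rcases hy.1.eq_or_lt with rfl | h0
    · rw [(OddPer.cut h ha).zero]
      rcases hy'.1.eq_or_lt with rfl | h0'
      · rw [(OddPer.cut h ha).zero]; simp
      · have h1 := tail_cut h ha ⟨h0', hy'.2⟩
        have h2 := h.tail_le hy'.1
        have h3 : max (D y' + M * (1 - y') - a) 0 ≤ M :=
          max_le (by linarith) h.mass_nonneg
        linarith
    · have h1 := tail_cut h ha ⟨h0.trans_le hle, hy'.2⟩
      have h2 := tail_cut h ha ⟨h0, hy.2⟩
      have h3 : max (D y' + M * (1 - y') - a) 0 ≤ max (D y + M * (1 - y) - a) 0 :=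
        max_le_max (by have := h.slope y y' hle; linarith) le_rfl
      linarith

theorem abs_sub_cut_le (h : State M D) (ha : 0 ≤ a) (y : ℝ) : |D y - cut M a D y| ≤ a := by
  refine (h.toOddPer.sub (OddPer.cut h ha)).abs_le (fun y hy => ?_) y
  rcases hy.1.eq_or_lt with rfl | h0
  · rw [h.zero, (OddPer.cut h ha).zero]; simpa
  · have h1 := tail_cut h ha ⟨h0, hy.2⟩
    have h2 := h.tail_nonneg hy.2
    have : D y - cut M a D y = (D y + M * (1 - y)) - max (D y + M * (1 - y) - a) 0 := by
      rw [← h1]; ring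
    rw [this, abs_le]
    rcases le_total (D y + M * (1 - y) - a) 0 with hl | hl
    · rw [max_eq_right hl]; constructor <;> linarith
    · rw [max_eq_left hl]; constructor <;> linarith

theorem abs_cut_sub_cut_le (h : State M D) (h' : State M D') (ha : 0 ≤ a)
    (hc : ∀ y, |D y - D' y| ≤ c) (y : ℝ) : |cut M a D y - cut M a D' y| ≤ c := by
  refine ((OddPer.cut h ha).sub (OddPer.cut h' ha)).abs_le (fun y hy => ?_) y
  rcases hy.1.eq_or_lt with rfl | h0
  · rw [(OddPer.cut h ha).zero, (OddPer.cut h' ha).zero]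
    simpa using (abs_nonneg _).trans (hc 0)
  · have h1 := tail_cut h ha ⟨h0, hy.2⟩
    have h2 := tail_cut h' ha ⟨h0, hy.2⟩
    have : cut M a D y - cut M a D' y =
        max (D y + M * (1 - y) - a) 0 - max (D' y + M * (1 - y) - a) 0 := by
      rw [← h1, ← h2]; ring
    rw [this]
    refine (abs_max_sub_max_le_abs _ _ _).trans ?_
    have := hc y
    ring_nf at this ⊢
    exact this

theorem cut_mono (h : State M D) (h' : State M D') (ha : 0 ≤ a)
    (hle : ∀ y ∈ Icc (0 : ℝ) 1, D y ≤ D' y) : ∀ y ∈ Icc (0 : ℝ) 1, cut M a D y ≤ cut M a D' y := by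
  intro y hy
  rcases hy.1.eq_or_lt with rfl | h0
  · rw [(OddPer.cut h ha).zero, (OddPer.cut h' ha).zero]
  · have h1 := tail_cut h ha ⟨h0, hy.2⟩
    have h2 := tail_cut h' ha ⟨h0, hy.2⟩
    have := max_le_max (show D y + M * (1 - y) - a ≤ D' y + M * (1 - y) - a by
      linarith [hle y hy]) (le_refl (0 : ℝ))
    linarith

theorem cut_cut (h : State M D) (ha : 0 ≤ a) (hb : 0 ≤ b) :
    cut M b (cut M a D) = cut M (a + b) D := by
  refine (OddPer.cut (h.cut ha) hb).ext01 (OddPer.cut h (add_nonneg ha hb)) fun y hy => ?_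
  rcases hy.1.eq_or_lt with rfl | h0
  · rw [(OddPer.cut (h.cut ha) hb).zero, (OddPer.cut h (add_nonneg ha hb)).zero]
  · have h1 := tail_cut (h.cut ha) hb ⟨h0, hy.2⟩
    rw [tail_cut h ha ⟨h0, hy.2⟩, ← max_sub_sub_right, max_assoc, max_eq_right (by linarith : 0 - b ≤ 0)] at h1
    have h2 := tail_cut h (add_nonneg ha hb) ⟨h0, hy.2⟩
    rw [show D y + M * (1 - y) - (a + b) = D y + M * (1 - y) - a - b by ring] at h2
    linarith

theorem gaussAvg_mono (h : OddPer D) (h' : OddPer D') {t : ℝ} (ht : 0 ≤ t)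
    (hle : ∀ y ∈ Icc (0 : ℝ) 1, D y ≤ D' y) :
    ∀ y ∈ Icc (0 : ℝ) 1, gaussAvg t D y ≤ gaussAvg t D' y := by
  intro y hy
  have := (h'.sub h).gaussAvg_nonneg (fun x hx => sub_nonneg.2 (hle x hx)) ht hy
  obtain ⟨B, hB⟩ := h.bdd
  obtain ⟨B', hB'⟩ := h'.bdd
  rw [gaussAvg_sub h'.meas hB' h.meas hB] at this
  linarith

theorem abs_gaussAvg_sub_le {B B' : ℝ} (hD : Measurable D) (hB : ∀ y, |D y| ≤ B)
    (hD' : Measurable D') (hB' : ∀ y, |D' y| ≤ B') (hc : ∀ y, |D y - D' y| ≤ c) (t y : ℝ) :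
    |gaussAvg t D y - gaussAvg t D' y| ≤ c := by
  rw [← gaussAvg_sub hD hB hD' hB']
  exact gaussAvg_abs_le hc t y

/-- Cutting after averaging gives less than cutting before: the average of the removed part is at
most `a`, and a tail function stays nonnegative. -/
theorem cut_gaussAvg_le (h : State M D) (ha : 0 ≤ a) (b : ℝ) :
    ∀ y ∈ Icc (0 : ℝ) 1, cut M a (gaussAvg b D) y ≤ gaussAvg b (cut M a D) y := by
  intro y hy
  rcases hy.1.eq_or_lt with rfl | h0
  · rw [((h.gaussAvg b).cut ha).zero, ((h.cut ha).gaussAvg b).zero]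
  · have h1 := tail_cut (h.gaussAvg b) ha ⟨h0, hy.2⟩
    have h2 := ((h.cut ha).gaussAvg b).tail_nonneg hy.2
    have h3 := abs_gaussAvg_sub_le h.meas h.abs_le (h.cut ha).meas (h.cut ha).abs_le
      (abs_sub_cut_le h ha) b y
    have h4 := (abs_le.1 h3).2
    have : max (gaussAvg b D y + M * (1 - y) - a) 0 ≤ gaussAvg b (cut M a D) y + M * (1 - y) :=
      max_le (by linarith) h2
    linarith

end Cut

/-- One step of length `δ` of the upper barrier: cut and paste, then heat flow. -/
def upStep (M j δ : ℝ) (D : ℝ → ℝ) : ℝ → ℝ := gaussAvg δ (cut M (j * δ) D)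

/-- One step of length `δ` of the lower barrier: heat flow, then cut and paste. -/
def lowStep (M j δ : ℝ) (D : ℝ → ℝ) : ℝ → ℝ := cut M (j * δ) (gaussAvg δ D)

section Steps

theorem State.upStep (h : State M D) (hj : 0 ≤ j) (hδ : 0 ≤ δ) : State M (upStep M j δ D) :=
  (h.cut (mul_nonneg hj hδ)).gaussAvg δ

theorem State.lowStep (h : State M D) (hj : 0 ≤ j) (hδ : 0 ≤ δ) : State M (lowStep M j δ D) :=
  (h.gaussAvg δ).cut (mul_nonneg hj hδ)

theorem upStep_mono (h : State M D) (h' : State M D') (hj : 0 ≤ j) (hδ : 0 ≤ δ)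
    (hle : ∀ y ∈ Icc (0 : ℝ) 1, D y ≤ D' y) :
    ∀ y ∈ Icc (0 : ℝ) 1, upStep M j δ D y ≤ upStep M j δ D' y :=
  gaussAvg_mono (OddPer.cut h (mul_nonneg hj hδ)) (OddPer.cut h' (mul_nonneg hj hδ)) hδ
    (cut_mono h h' (mul_nonneg hj hδ) hle)

theorem lowStep_mono (h : State M D) (h' : State M D') (hj : 0 ≤ j) (hδ : 0 ≤ δ)
    (hle : ∀ y ∈ Icc (0 : ℝ) 1, D y ≤ D' y) :
    ∀ y ∈ Icc (0 : ℝ) 1, lowStep M j δ D y ≤ lowStep M j δ D' y :=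
  cut_mono (h.gaussAvg δ) (h'.gaussAvg δ) (mul_nonneg hj hδ)
    (gaussAvg_mono h.toOddPer h'.toOddPer hδ hle)

theorem upStep_upStep_le (h : State M D) (hj : 0 ≤ j) (ha : 0 ≤ a) (hb : 0 ≤ b) :
    ∀ y ∈ Icc (0 : ℝ) 1, upStep M j b (upStep M j a D) y ≤ upStep M j (a + b) D y := by
  have hja := mul_nonneg hj ha
  have hjb := mul_nonneg hj hb
  have hc := h.cut hja
  intro y hy
  unfold upStep
  refine (gaussAvg_mono (OddPer.cut (hc.gaussAvg a) hjb) ((hc.cut hjb).gaussAvg a).toOddPer hb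
    (cut_gaussAvg_le hc hjb a) y hy).trans_eq ?_
  rw [gaussAvg_gaussAvg (hc.cut hjb).meas (hc.cut hjb).abs_le hb ha, cut_cut h hja hjb, mul_add,
    add_comm b a]

theorem lowStep_le_lowStep (h : State M D) (hj : 0 ≤ j) (ha : 0 ≤ a) (hb : 0 ≤ b) :
    ∀ y ∈ Icc (0 : ℝ) 1, lowStep M j (a + b) D y ≤ lowStep M j b (lowStep M j a D) y := by
  have hja := mul_nonneg hj ha
  have hjb := mul_nonneg hj hb
  intro y hy
  have hg := h.gaussAvg a
  have e : lowStep M j (a + b) D y =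
      cut M (j * b) (cut M (j * a) (gaussAvg b (gaussAvg a D))) y := by
    rw [cut_cut (hg.gaussAvg b) hja hjb, gaussAvg_gaussAvg h.meas h.abs_le hb ha, add_comm b a,
      ← mul_add]
    rfl
  rw [e]
  exact cut_mono ((hg.gaussAvg b).cut hja) ((hg.cut hja).gaussAvg b) hjb
    (cut_gaussAvg_le hg hja b) y hy

theorem abs_lowStep_sub_le (h : State M D) (h' : State M D') (hj : 0 ≤ j) (hδ : 0 ≤ δ)
    (hc : ∀ y, |D y - D' y| ≤ c) (y : ℝ) : |lowStep M j δ D y - lowStep M j δ D' y| ≤ c :=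
  abs_cut_sub_cut_le (h.gaussAvg δ) (h'.gaussAvg δ) (mul_nonneg hj hδ)
    (abs_gaussAvg_sub_le h.meas h.abs_le h'.meas h'.abs_le hc δ) y

theorem abs_upStep_sub_le (h : State M D) (h' : State M D') (hj : 0 ≤ j) (hδ : 0 ≤ δ)
    (hc : ∀ y, |D y - D' y| ≤ c) (y : ℝ) : |upStep M j δ D y - upStep M j δ D' y| ≤ c :=
  abs_gaussAvg_sub_le (h.cut (mul_nonneg hj hδ)).meas (h.cut (mul_nonneg hj hδ)).abs_le
    (h'.cut (mul_nonneg hj hδ)).meas (h'.cut (mul_nonneg hj hδ)).abs_le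
    (abs_cut_sub_cut_le h h' (mul_nonneg hj hδ) hc) δ y

end Steps

section Iterates

theorem State.upIter (h : State M D) (hj : 0 ≤ j) (hδ : 0 ≤ δ) (n : ℕ) :
    State M ((CutPaste.upStep M j δ)^[n] D) := by
  induction n with
  | zero => exact h
  | succ n ih => rw [Function.iterate_succ_apply']; exact ih.upStep hj hδ

theorem State.lowIter (h : State M D) (hj : 0 ≤ j) (hδ : 0 ≤ δ) (n : ℕ) :
    State M ((CutPaste.lowStep M j δ)^[n] D) := by
  induction n with
  | zero => exact h
  | succ n ih => rw [Function.iterate_succ_apply']; exact ih.lowStep hj hδ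

theorem abs_lowIter_sub_le (h : State M D) (h' : State M D') (hj : 0 ≤ j) (hδ : 0 ≤ δ)
    (hc : ∀ y, |D y - D' y| ≤ c) (n : ℕ) :
    ∀ y, |(lowStep M j δ)^[n] D y - (lowStep M j δ)^[n] D' y| ≤ c := by
  induction n with
  | zero => exact hc
  | succ n ih =>
    rw [Function.iterate_succ_apply', Function.iterate_succ_apply']
    exact abs_lowStep_sub_le (h.lowIter hj hδ n) (h'.lowIter hj hδ n) hj hδ ih

theorem abs_upIter_sub_le (h : State M D) (h' : State M D') (hj : 0 ≤ j) (hδ : 0 ≤ δ)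
    (hc : ∀ y, |D y - D' y| ≤ c) (n : ℕ) :
    ∀ y, |(upStep M j δ)^[n] D y - (upStep M j δ)^[n] D' y| ≤ c := by
  induction n with
  | zero => exact hc
  | succ n ih =>
    rw [Function.iterate_succ_apply', Function.iterate_succ_apply']
    exact abs_upStep_sub_le (h.upIter hj hδ n) (h'.upIter hj hδ n) hj hδ ih

/-- Cut and paste intertwines the two iterations, `K (G K)ⁿ = (K G)ⁿ K`. -/
theorem cut_upIter (n : ℕ) (D : ℝ → ℝ) : cut M (j * δ) ((upStep M j δ)^[n] D) =
    (lowStep M j δ)^[n] (cut M (j * δ) D) := by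
  have : Function.Semiconj (cut M (j * δ)) (upStep M j δ) (lowStep M j δ) := fun D => rfl
  exact this.iterate_right n D

/-- The gap between the barriers with step `δ`: by the intertwining it costs two cuts of mass `j δ`. -/
theorem abs_upIter_sub_lowIter_le (h : State M D) (hj : 0 ≤ j) (hδ : 0 ≤ δ) (n : ℕ) (y : ℝ) :
    |(upStep M j δ)^[n] D y - (lowStep M j δ)^[n] D y| ≤ 2 * (j * δ) := by
  have hjd := mul_nonneg hj hδ
  have h1 := abs_sub_cut_le (h.upIter hj hδ n) hjd y
  rw [cut_upIter] at h1
  have h2 := abs_lowIter_sub_le h (h.cut hjd) hj hδ (abs_sub_cut_le h hjd) n y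
  rw [abs_sub_comm] at h2
  have := (abs_sub_le _ _ _).trans (add_le_add h1 h2)
  linarith

/-- The upper barrier along a list of time steps of varying length. -/
def upList (M j : ℝ) (l : List ℝ) (D : ℝ → ℝ) : ℝ → ℝ := l.foldl (fun D δ => upStep M j δ D) D

/-- The lower barrier along a list of time steps of varying length. -/
def lowList (M j : ℝ) (l : List ℝ) (D : ℝ → ℝ) : ℝ → ℝ := l.foldl (fun D δ => lowStep M j δ D) D

theorem upList_cons (l : List ℝ) (D : ℝ → ℝ) :
    upList M j (a :: l) D = upList M j l (upStep M j a D) := rfl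

theorem lowList_cons (l : List ℝ) (D : ℝ → ℝ) :
    lowList M j (a :: l) D = lowList M j l (lowStep M j a D) := rfl

theorem upList_replicate (n : ℕ) (D : ℝ → ℝ) :
    upList M j (List.replicate n δ) D = (upStep M j δ)^[n] D := by
  induction n generalizing D with
  | zero => rfl
  | succ n ih => exact ih _

theorem lowList_replicate (n : ℕ) (D : ℝ → ℝ) :
    lowList M j (List.replicate n δ) D = (lowStep M j δ)^[n] D := by
  induction n generalizing D with
  | zero => rfl
  | succ n ih => exact ih _

theorem upList_append (l l' : List ℝ) (D : ℝ → ℝ) :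
    upList M j (l ++ l') D = upList M j l' (upList M j l D) := List.foldl_append

theorem lowList_append (l l' : List ℝ) (D : ℝ → ℝ) :
    lowList M j (l ++ l') D = lowList M j l' (lowList M j l D) := List.foldl_append

theorem upList_mono (hj : 0 ≤ j) (l : List ℝ) (hl : ∀ a ∈ l, 0 < a) :
    ∀ D D', State M D → State M D' → (∀ y ∈ Icc (0 : ℝ) 1, D y ≤ D' y) →
      ∀ y ∈ Icc (0 : ℝ) 1, upList M j l D y ≤ upList M j l D' y := by
  induction l with
  | nil => intro D D' _ _ h; exact h
  | cons a l ih =>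
    intro D D' h h' hle
    have ha : 0 ≤ a := (hl a (by simp)).le
    exact ih (fun b hb => hl b (by simp [hb])) _ _ (h.upStep hj ha) (h'.upStep hj ha)
      (upStep_mono h h' hj ha hle)

theorem lowList_mono (hj : 0 ≤ j) (l : List ℝ) (hl : ∀ a ∈ l, 0 < a) :
    ∀ D D', State M D → State M D' → (∀ y ∈ Icc (0 : ℝ) 1, D y ≤ D' y) →
      ∀ y ∈ Icc (0 : ℝ) 1, lowList M j l D y ≤ lowList M j l D' y := by
  induction l with
  | nil => intro D D' _ _ h; exact h
  | cons a l ih =>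
    intro D D' h h' hle
    have ha : 0 ≤ a := (hl a (by simp)).le
    exact ih (fun b hb => hl b (by simp [hb])) _ _ (h.lowStep hj ha) (h'.lowStep hj ha)
      (lowStep_mono h h' hj ha hle)

theorem list_sum_nonneg (l : List ℝ) (hl : ∀ a ∈ l, 0 < a) : 0 ≤ l.sum :=
  List.sum_nonneg fun a ha => (hl a ha).le

/-- Lower barriers lie below upper barriers with the same final time, for arbitrary partitions. The
longer of the two first steps is split, which only brings the two sides closer together. -/
theorem lowList_le_upList (hj : 0 ≤ j) (n : ℕ) : ∀ l l' : List ℝ, l.length + l'.length ≤ n →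
    (∀ a ∈ l, 0 < a) → (∀ a ∈ l', 0 < a) → l.sum = l'.sum →
    ∀ D D', State M D → State M D' → (∀ y ∈ Icc (0 : ℝ) 1, D y ≤ D' y) →
      ∀ y ∈ Icc (0 : ℝ) 1, lowList M j l D y ≤ upList M j l' D' y := by
  induction n with
  | zero =>
    intro l l' hn _ _ _ D D' _ _ hle
    have h1 : l = [] := List.eq_nil_of_length_eq_zero (by omega)
    have h2 : l' = [] := List.eq_nil_of_length_eq_zero (by omega)
    subst h1 h2
    exact hle
  | succ n ih =>
    intro l l' hn hl hl' hsum D D' h h' hle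
    rcases l with _ | ⟨a, l⟩
    · rcases l' with _ | ⟨b, l'⟩
      · exact hle
      · exfalso
        have h1 := hl' b (by simp)
        have h2 := list_sum_nonneg l' fun c hc => hl' c (by simp [hc])
        simp only [List.sum_nil, List.sum_cons] at hsum
        linarith
    rcases l' with _ | ⟨b, l'⟩
    · exfalso
      have h1 := hl a (by simp)
      have h2 := list_sum_nonneg l fun c hc => hl c (by simp [hc])
      simp only [List.sum_nil, List.sum_cons] at hsum
      linarith
    have ha := hl a (by simp)
    have hb := hl' b (by simp)
    have hlt : ∀ c ∈ l, 0 < c := fun c hc => hl c (by simp [hc])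
    have hlt' : ∀ c ∈ l', 0 < c := fun c hc => hl' c (by simp [hc])
    simp only [List.sum_cons] at hsum
    simp only [List.length_cons] at hn
    rw [lowList_cons, upList_cons]
    -- one common step of length `d` keeps the two sides ordered
    have hstep : ∀ d, 0 ≤ d → ∀ y ∈ Icc (0 : ℝ) 1, lowStep M j d D y ≤ upStep M j d D' y :=
      fun d hd y hy => by
        have h1 : lowStep M j d D y ≤ upStep M j d D y :=
          cut_gaussAvg_le h (mul_nonneg hj hd) d y hy
        exact h1.trans (upStep_mono h h' hj hd hle y hy)
    rcases lt_trichotomy a b with hab | rfl | hab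
    · intro y hy
      have hc : 0 < b - a := sub_pos.2 hab
      have h1 := ih l ((b - a) :: l') (by simp only [List.length_cons]; omega) hlt
        (by
          intro c hc'
          rcases List.mem_cons.1 hc' with rfl | hc'
          · exact hc
          · exact hlt' c hc')
        (by rw [List.sum_cons]; linarith) _ _ (h.lowStep hj ha.le) (h'.upStep hj ha.le)
        (hstep a ha.le) y hy
      refine h1.trans ?_
      rw [upList_cons]
      have h2 := upStep_upStep_le h' hj ha.le hc.le
      rw [add_sub_cancel] at h2
      exact upList_mono hj l' hlt' _ _ ((h'.upStep hj ha.le).upStep hj hc.le)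
        (h'.upStep hj hb.le) h2 y hy
    · exact ih l l' (by omega) hlt hlt' (by linarith) _ _ (h.lowStep hj ha.le)
        (h'.upStep hj ha.le) (hstep a ha.le)
    · intro y hy
      have hc : 0 < a - b := sub_pos.2 hab
      have h1 := ih ((a - b) :: l) l' (by simp only [List.length_cons]; omega)
        (by
          intro c hc'
          rcases List.mem_cons.1 hc' with rfl | hc'
          · exact hc
          · exact hlt c hc')
        hlt' (by rw [List.sum_cons]; linarith) _ _ (h.lowStep hj hb.le) (h'.upStep hj hb.le)
        (hstep b hb.le) y hy
      refine le_trans ?_ h1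
      rw [lowList_cons]
      have h2 := lowStep_le_lowStep h hj hb.le hc.le
      rw [add_sub_cancel] at h2
      exact lowList_mono hj l hlt _ _ (h.lowStep hj ha.le)
        ((h.lowStep hj hb.le).lowStep hj hc.le) h2 y hy

/-- Duhamel estimate for the upper barrier, after a further average over time `τ`. The part cut off in
a step is bounded by `j δ`, and the average over the remaining time makes it Lipschitz; the sum
of the constants `j δ / √(τ + m δ)`, `1 ≤ m ≤ n`, telescopes through
`δ / √(x + δ) ≤ 2 (√(x + δ) - √x)`. -/
theorem gaussAvg_upIter_sub_lipschitz (h : State M D) (hj : 0 ≤ j) (hδ : 0 < δ) (n : ℕ) :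
    ∀ τ, 0 ≤ τ → ∀ y y' : ℝ,
      |(gaussAvg τ ((upStep M j δ)^[n] D) y - gaussAvg (τ + n * δ) D y) -
        (gaussAvg τ ((upStep M j δ)^[n] D) y' - gaussAvg (τ + n * δ) D y')| ≤
      2 * j * (√(τ + n * δ) - √τ) * |y - y'| := by
  induction n with
  | zero => intro τ _ y y'; simp
  | succ n ih =>
    intro τ hτ y y'
    have hjd := mul_nonneg hj hδ.le
    set X := (upStep M j δ)^[n] D with hX
    have sX : State M X := h.upIter hj hδ.le n
    have sc := sX.cut hjd
    have hτδ : 0 < τ + δ := by linarith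
    have e1 : gaussAvg τ ((upStep M j δ)^[n + 1] D) = gaussAvg (τ + δ) (cut M (j * δ) X) := by
      rw [Function.iterate_succ_apply', ← hX, upStep,
        gaussAvg_gaussAvg sc.meas sc.abs_le hτ hδ.le]
    have e2 : τ + (n + 1 : ℕ) * δ = τ + δ + n * δ := by push_cast; ring
    rw [e1, e2]
    have h1 := ih (τ + δ) hτδ.le y y'
    have h2 := gaussAvg_lipschitz (sX.toOddPer.sub sc.toOddPer).meas
      (abs_sub_cut_le sX hjd) hτδ y y'
    rw [gaussAvg_sub sX.meas sX.abs_le sc.meas sc.abs_le,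
      gaussAvg_sub sX.meas sX.abs_le sc.meas sc.abs_le] at h2
    -- the telescoping bound, from `0 ≤ (√(τ + δ) - √τ) ^ 2`
    have h3 : j * δ / √(τ + δ) ≤ 2 * j * (√(τ + δ) - √τ) := by
      have p := Real.sqrt_pos.2 hτδ
      rw [div_le_iff₀ p]
      have q1 := Real.mul_self_sqrt hτδ.le
      have q2 := Real.mul_self_sqrt hτ
      have q3 : 0 ≤ (√(τ + δ) - √τ) * (√(τ + δ) - √τ) := mul_self_nonneg _
      have q4 : δ ≤ 2 * (√(τ + δ) - √τ) * √(τ + δ) := by nlinarith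
      calc j * δ ≤ j * (2 * (√(τ + δ) - √τ) * √(τ + δ)) := mul_le_mul_of_nonneg_left q4 hj
        _ = _ := by ring
    have h4 := mul_le_mul_of_nonneg_right h3 (abs_nonneg (y - y'))
    have h5 := abs_sub ((gaussAvg (τ + δ) X y - gaussAvg (τ + δ + n * δ) D y) -
        (gaussAvg (τ + δ) X y' - gaussAvg (τ + δ + n * δ) D y'))
      (gaussAvg (τ + δ) X y - gaussAvg (τ + δ) (cut M (j * δ) X) y -
        (gaussAvg (τ + δ) X y' - gaussAvg (τ + δ) (cut M (j * δ) X) y'))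
    refine le_trans (le_of_eq ?_) (h5.trans ((add_le_add h1 (h2.trans h4)).trans (le_of_eq ?_)))
    · congr 1; ring
    · ring

theorem abs_upIter_sub_gaussAvg_le (h : State M D) (hj : 0 ≤ j) (hδ : 0 ≤ δ) (n : ℕ) :
    ∀ y, |(upStep M j δ)^[n] D y - gaussAvg (n * δ) D y| ≤ n * (j * δ) := by
  induction n with
  | zero => intro y; simp [gaussAvg_zero]
  | succ n ih =>
    intro y
    have hjd := mul_nonneg hj hδ
    set X := (upStep M j δ)^[n] D with hX
    have sX : State M X := h.upIter hj hδ n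
    have sc := sX.cut hjd
    have e2 : ((n + 1 : ℕ) : ℝ) * δ = δ + n * δ := by push_cast; ring
    rw [Function.iterate_succ_apply', ← hX, e2,
      ← gaussAvg_gaussAvg h.meas h.abs_le hδ (by positivity)]
    refine abs_gaussAvg_sub_le sc.meas sc.abs_le (h.gaussAvg _).meas (h.gaussAvg _).abs_le
      (fun z => ?_) δ y
    have h1 := abs_sub_cut_le sX hjd z
    rw [abs_sub_comm] at h1
    refine (abs_sub_le _ (X z) _).trans ((add_le_add h1 (ih z)).trans (le_of_eq ?_))
    push_cast
    ring

end Iterates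

end Deviations

/-! ### The common limit of the barriers -/

section Evolution

variable {M j t : ℝ} {D D' : ℝ → ℝ}

/-- The upper barrier at time `t` with `n + 1` equal steps. -/
def unifUp (M j t : ℝ) (D : ℝ → ℝ) (n : ℕ) : ℝ → ℝ := (upStep M j (t / (n + 1)))^[n + 1] D

/-- The lower barrier at time `t` with `n + 1` equal steps. -/
def unifLow (M j t : ℝ) (D : ℝ → ℝ) (n : ℕ) : ℝ → ℝ := (lowStep M j (t / (n + 1)))^[n + 1] D

theorem State.unifUp (h : State M D) (hj : 0 ≤ j) (ht : 0 ≤ t) (n : ℕ) :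
    State M (unifUp M j t D n) :=
  h.upIter hj (by positivity) _

theorem State.unifLow (h : State M D) (hj : 0 ≤ j) (ht : 0 ≤ t) (n : ℕ) :
    State M (unifLow M j t D n) :=
  h.lowIter hj (by positivity) _

theorem abs_unifUp_sub_unifLow_le (h : State M D) (hj : 0 ≤ j) (ht : 0 ≤ t) (n : ℕ) (y : ℝ) :
    |unifUp M j t D n y - unifLow M j t D n y| ≤ 2 * j * t * (1 / (n + 1)) := by
  have := abs_upIter_sub_lowIter_le h hj (δ := t / (n + 1)) (by positivity) (n + 1) y
  refine this.trans_eq ?_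
  ring

theorem sum_replicate_div (t : ℝ) (n : ℕ) : (List.replicate (n + 1) (t / (n + 1))).sum = t := by
  rw [List.sum_replicate, nsmul_eq_mul]
  push_cast
  field_simp

theorem unifUp_eq_upList (t : ℝ) (D : ℝ → ℝ) (n : ℕ) :
    unifUp M j t D n = upList M j (List.replicate (n + 1) (t / (n + 1))) D :=
  (upList_replicate _ _).symm

theorem unifLow_eq_lowList (t : ℝ) (D : ℝ → ℝ) (n : ℕ) :
    unifLow M j t D n = lowList M j (List.replicate (n + 1) (t / (n + 1))) D :=
  (lowList_replicate _ _).symm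

theorem replicate_div_pos (ht : 0 < t) (n : ℕ) :
    ∀ a ∈ List.replicate (n + 1) (t / ((n : ℝ) + 1)), 0 < a := by
  intro a ha
  rw [List.eq_of_mem_replicate ha]
  positivity

theorem lowList_le_unifUp (h : State M D) (hj : 0 ≤ j) (ht : 0 < t) {l : List ℝ}
    (hl : ∀ a ∈ l, 0 < a) (hs : l.sum = t) (n : ℕ) :
    ∀ y ∈ Icc (0 : ℝ) 1, lowList M j l D y ≤ unifUp M j t D n y := by
  rw [unifUp_eq_upList]
  exact lowList_le_upList hj _ l _ le_rfl hl (replicate_div_pos ht n)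
    (by rw [sum_replicate_div, hs]) D D h h fun _ _ => le_rfl

theorem unifLow_le_upList (h : State M D) (hj : 0 ≤ j) (ht : 0 < t) {l : List ℝ}
    (hl : ∀ a ∈ l, 0 < a) (hs : l.sum = t) (n : ℕ) :
    ∀ y ∈ Icc (0 : ℝ) 1, unifLow M j t D n y ≤ upList M j l D y := by
  rw [unifLow_eq_lowList]
  exact lowList_le_upList hj _ _ l le_rfl (replicate_div_pos ht n) hl
    (by rw [sum_replicate_div, hs]) D D h h fun _ _ => le_rfl

theorem unifLow_le_unifUp (h : State M D) (hj : 0 ≤ j) (ht : 0 < t) (m n : ℕ) :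
    ∀ y ∈ Icc (0 : ℝ) 1, unifLow M j t D m y ≤ unifUp M j t D n y := by
  rw [unifLow_eq_lowList]
  exact lowList_le_unifUp h hj ht (replicate_div_pos ht m) (sum_replicate_div t m) n

theorem abs_unifUp_sub_unifUp_le (h : State M D) (hj : 0 ≤ j) (ht : 0 < t) {m n : ℕ}
    (hmn : m ≤ n) (y : ℝ) :
    |unifUp M j t D m y - unifUp M j t D n y| ≤ 2 * j * t * (1 / (m + 1)) := by
  refine ((h.unifUp hj ht.le m).toOddPer.sub (h.unifUp hj ht.le n).toOddPer).abs_le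
    (fun y hy => ?_) y
  have h1 := (abs_le.1 (abs_unifUp_sub_unifLow_le h hj ht.le m y)).2
  have h2 := (abs_le.1 (abs_unifUp_sub_unifLow_le h hj ht.le n y)).2
  have h3 := unifLow_le_unifUp h hj ht m n y hy
  have h4 := unifLow_le_unifUp h hj ht n m y hy
  have h5 : 1 / ((n : ℝ) + 1) ≤ 1 / (m + 1) := by gcongr
  have h6 := mul_le_mul_of_nonneg_left h5 (by positivity : 0 ≤ 2 * j * t)
  rw [abs_le]
  constructor <;> linarith

theorem tendsto_mul_one_div_add_atTop (c : ℝ) : Tendsto (fun n : ℕ => c * (1 / ((n : ℝ) + 1))) atTop (𝓝 0) := by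
  simpa using tendsto_one_div_add_atTop_nhds_zero_nat.const_mul c

theorem cauchySeq_unifUp (h : State M D) (hj : 0 ≤ j) (ht : 0 < t) (y : ℝ) :
    CauchySeq fun n => unifUp M j t D n y := by
  refine cauchySeq_of_le_tendsto_0 (fun m : ℕ => 2 * (2 * j * t) * (1 / ((m : ℝ) + 1)))
    (fun n m N hn hm => ?_) (tendsto_mul_one_div_add_atTop _)
  rw [Real.dist_eq]
  have h1 := abs_unifUp_sub_unifUp_le h hj ht hn y
  have h2 := abs_unifUp_sub_unifUp_le h hj ht hm y
  rw [abs_sub_comm] at h1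
  refine (abs_sub_le _ _ _).trans ((add_le_add h1 h2).trans (le_of_eq ?_))
  ring

/-- The common limit at time `t` of the barriers started from `D`. For `t ≤ 0` it is `D`, which is the
right value at `t = 0`; negative times play no role. -/
def evolve (M j t : ℝ) (D : ℝ → ℝ) (y : ℝ) : ℝ :=
  if 0 < t then limUnder atTop fun n => unifUp M j t D n y else D y

theorem evolve_zero : evolve M j 0 D = D := by
  funext y
  simp [evolve]

theorem tendsto_unifUp (h : State M D) (hj : 0 ≤ j) (ht : 0 < t) (y : ℝ) :
    Tendsto (fun n => unifUp M j t D n y) atTop (𝓝 (evolve M j t D y)) := by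
  rw [evolve, if_pos ht]
  exact CauchySeq.tendsto_limUnder (cauchySeq_unifUp h hj ht y)

theorem tendsto_unifLow (h : State M D) (hj : 0 ≤ j) (ht : 0 < t) (y : ℝ) :
    Tendsto (fun n => unifLow M j t D n y) atTop (𝓝 (evolve M j t D y)) := by
  have h1 : Tendsto (fun n => unifUp M j t D n y - unifLow M j t D n y) atTop (𝓝 0) :=
    squeeze_zero_norm (fun n => abs_unifUp_sub_unifLow_le h hj ht.le n y) (tendsto_mul_one_div_add_atTop _)
  simpa using (tendsto_unifUp h hj ht y).sub h1

theorem abs_unifUp_sub_evolve_le (h : State M D) (hj : 0 ≤ j) (ht : 0 < t) (n : ℕ) (y : ℝ) :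
    |unifUp M j t D n y - evolve M j t D y| ≤ 2 * j * t * (1 / (n + 1)) :=
  le_of_tendsto (((tendsto_unifUp h hj ht y).const_sub _).abs)
    (eventually_atTop.2 ⟨n, fun _ hm => abs_unifUp_sub_unifUp_le h hj ht hm y⟩)

theorem State.evolve (h : State M D) (hj : 0 ≤ j) (ht : 0 ≤ t) : State M (evolve M j t D) := by
  rcases ht.eq_or_lt with rfl | ht
  · rwa [evolve_zero]
  · exact State.of_tendsto (h.unifUp hj ht.le) (tendsto_unifUp h hj ht)

theorem lowList_le_evolve (h : State M D) (hj : 0 ≤ j) (ht : 0 < t) {l : List ℝ}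
    (hl : ∀ a ∈ l, 0 < a) (hs : l.sum = t) :
    ∀ y ∈ Icc (0 : ℝ) 1, lowList M j l D y ≤ evolve M j t D y := fun y hy =>
  ge_of_tendsto' (tendsto_unifUp h hj ht y) fun n => lowList_le_unifUp h hj ht hl hs n y hy

theorem evolve_le_upList (h : State M D) (hj : 0 ≤ j) (ht : 0 < t) {l : List ℝ}
    (hl : ∀ a ∈ l, 0 < a) (hs : l.sum = t) :
    ∀ y ∈ Icc (0 : ℝ) 1, evolve M j t D y ≤ upList M j l D y := fun y hy =>
  le_of_tendsto' (tendsto_unifLow h hj ht y) fun n => unifLow_le_upList h hj ht hl hs n y hy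

theorem lowIter_le_evolve (h : State M D) (hj : 0 ≤ j) {δ : ℝ} (hδ : 0 < δ) (k : ℕ) :
    ∀ y ∈ Icc (0 : ℝ) 1, (lowStep M j δ)^[k] D y ≤ evolve M j (k * δ) D y := by
  rcases Nat.eq_zero_or_pos k with rfl | hk
  · intro y _
    simp [evolve_zero]
  · rw [← lowList_replicate]
    refine lowList_le_evolve h hj (by positivity) (fun a ha => ?_) (by simp)
    rwa [List.eq_of_mem_replicate ha]

theorem evolve_le_upIter (h : State M D) (hj : 0 ≤ j) {δ : ℝ} (hδ : 0 < δ) (k : ℕ) :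
    ∀ y ∈ Icc (0 : ℝ) 1, evolve M j (k * δ) D y ≤ (upStep M j δ)^[k] D y := by
  rcases Nat.eq_zero_or_pos k with rfl | hk
  · intro y _
    simp [evolve_zero]
  · rw [← upList_replicate]
    refine evolve_le_upList h hj (by positivity) (fun a ha => ?_) (by simp)
    rwa [List.eq_of_mem_replicate ha]

/-- Semigroup property. Both sides are close to the upper barrier that takes `n + 1` equal steps on
`[0, s]` and `n + 1` equal steps on `[s, s + t]`. -/
theorem evolve_evolve (h : State M D) (hj : 0 ≤ j) {s : ℝ} (hs : 0 ≤ s) (ht : 0 ≤ t) :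
    evolve M j t (evolve M j s D) = evolve M j (s + t) D := by
  rcases hs.eq_or_lt with rfl | hs
  · rw [evolve_zero, zero_add]
  rcases ht.eq_or_lt with rfl | ht
  · rw [evolve_zero, add_zero]
  have hst : 0 < s + t := add_pos hs ht
  have hE := h.evolve hj hs.le
  refine (hE.evolve hj ht.le).toOddPer.ext01 (h.evolve hj hst.le).toOddPer fun y hy => ?_
  have key : ∀ n : ℕ, |evolve M j t (evolve M j s D) y - evolve M j (s + t) D y| ≤
      4 * j * (s + t) * (1 / (n + 1)) := by
    intro n
    have hU := h.unifUp hj hs.le n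
    have hL := h.unifLow hj hs.le n
    have htn : 0 ≤ t / ((n : ℝ) + 1) := by positivity
    set X := unifUp M j t (unifUp M j s D n) n with hX
    have a1 : |X y - unifUp M j t (evolve M j s D) n y| ≤ 2 * j * s * (1 / (n + 1)) :=
      abs_upIter_sub_le hU hE hj htn (abs_unifUp_sub_evolve_le h hj hs n) (n + 1) y
    have a2 := abs_unifUp_sub_evolve_le hE hj ht n y
    have b1 := abs_unifUp_sub_unifLow_le hU hj ht.le n y
    have b2 : |unifLow M j t (unifUp M j s D n) n y - unifLow M j t (unifLow M j s D n) n y| ≤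
        2 * j * s * (1 / (n + 1)) :=
      abs_lowIter_sub_le hU hL hj htn (abs_unifUp_sub_unifLow_le h hj hs.le n) (n + 1) y
    have hpos : ∀ a ∈ List.replicate (n + 1) (s / ((n : ℝ) + 1)) ++
        List.replicate (n + 1) (t / ((n : ℝ) + 1)), 0 < a := by
      intro a ha
      rcases List.mem_append.1 ha with ha | ha
      · exact replicate_div_pos hs n a ha
      · exact replicate_div_pos ht n a ha
    have hsum : (List.replicate (n + 1) (s / ((n : ℝ) + 1)) ++
        List.replicate (n + 1) (t / ((n : ℝ) + 1))).sum = s + t := by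
      rw [List.sum_append, sum_replicate_div, sum_replicate_div]
    have c1 := lowList_le_evolve h hj hst hpos hsum y hy
    have c2 := evolve_le_upList h hj hst hpos hsum y hy
    rw [lowList_append, ← unifLow_eq_lowList, ← unifLow_eq_lowList] at c1
    rw [upList_append, ← unifUp_eq_upList, ← unifUp_eq_upList, ← hX] at c2
    rw [← hX] at b1
    rw [abs_le] at a1 a2 b1 b2 ⊢
    constructor <;> nlinarith
  have := ge_of_tendsto' (tendsto_mul_one_div_add_atTop (4 * j * (s + t))) key
  exact sub_eq_zero.1 (abs_eq_zero.1 (le_antisymm this (abs_nonneg _)))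

theorem evolve_sub_gaussAvg_lipschitz (h : State M D) (hj : 0 ≤ j) (ht : 0 ≤ t) (y y' : ℝ) :
    |(evolve M j t D y - gaussAvg t D y) - (evolve M j t D y' - gaussAvg t D y')| ≤
      2 * j * √t * |y - y'| := by
  rcases ht.eq_or_lt with rfl | ht
  · simp [evolve_zero, gaussAvg_zero]
  refine le_of_tendsto' (((tendsto_unifUp h hj ht y).sub_const _).sub
    ((tendsto_unifUp h hj ht y').sub_const _)).abs fun n => ?_
  have := gaussAvg_upIter_sub_lipschitz h hj (δ := t / (n + 1)) (by positivity) (n + 1) 0 le_rfl y y'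
  have e : ((n + 1 : ℕ) : ℝ) * (t / (n + 1)) = t := by push_cast; field_simp
  rw [e, gaussAvg_zero, zero_add, Real.sqrt_zero, sub_zero] at this
  exact this

theorem abs_evolve_sub_gaussAvg_le (h : State M D) (hj : 0 ≤ j) (ht : 0 ≤ t) (y : ℝ) :
    |evolve M j t D y - gaussAvg t D y| ≤ j * t := by
  rcases ht.eq_or_lt with rfl | ht
  · simp [evolve_zero, gaussAvg_zero]
  refine le_of_tendsto' ((tendsto_unifUp h hj ht y).sub_const _).abs fun n => ?_
  have := abs_upIter_sub_gaussAvg_le h hj (δ := t / (n + 1)) (by positivity) (n + 1) y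
  have e : ((n + 1 : ℕ) : ℝ) * (t / (n + 1)) = t := by push_cast; field_simp
  rw [e] at this
  refine this.trans_eq ?_
  push_cast
  field_simp

section Regularity

variable {L : ℝ}

theorem gaussAvg_lipschitz_of_lipschitz (h : State M D)
    (hL : ∀ y y', |D y - D y'| ≤ L * |y - y'|) (t y y' : ℝ) :
    |gaussAvg t D y - gaussAvg t D y'| ≤ L * |y - y'| := by
  unfold gaussAvg
  rw [← integral_sub (integrable_shift h.meas h.abs_le t y) (integrable_shift h.meas h.abs_le t y')]
  have := norm_integral_le_of_norm_le_const (μ := gaussianReal 0 t.toNNReal)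
    (f := fun z => D (y + z) - D (y' + z)) (C := L * |y - y'|)
    (ae_of_all _ fun z => by simpa using hL (y + z) (y' + z))
  simpa using this

theorem evolve_lipschitz (h : State M D) (hL : ∀ y y', |D y - D y'| ≤ L * |y - y'|) (hj : 0 ≤ j)
    (ht : 0 ≤ t) (y y' : ℝ) :
    |evolve M j t D y - evolve M j t D y'| ≤ (L + 2 * j * √t) * |y - y'| := by
  have h1 := evolve_sub_gaussAvg_lipschitz h hj ht y y'
  have h2 := gaussAvg_lipschitz_of_lipschitz h hL t y y'
  rw [abs_le] at *
  constructor <;> linarith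

theorem abs_evolve_add_sub_le (h : State M D) (hL : ∀ y y', |D y - D y'| ≤ L * |y - y'|)
    (hj : 0 ≤ j) (ht : 0 ≤ t) {s : ℝ} (hs : 0 ≤ s) (y : ℝ) :
    |evolve M j (t + s) D y - evolve M j t D y| ≤ j * s + (L + 2 * j * √t) * √s := by
  have hE := h.evolve hj ht
  rw [← evolve_evolve h hj ht hs]
  exact (abs_sub_le _ _ _).trans (add_le_add (abs_evolve_sub_gaussAvg_le hE hj hs y)
    (gaussAvg_sub_self_le hE.meas hE.abs_le (evolve_lipschitz h hL hj ht) hs y))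

theorem abs_evolve_sub_evolve_le (h : State M D) (hL : ∀ y y', |D y - D y'| ≤ L * |y - y'|)
    (hj : 0 ≤ j) {s T : ℝ} (ht : 0 ≤ t) (hs : 0 ≤ s) (hT : t ≤ T) (hT' : s ≤ T) (y : ℝ) :
    |evolve M j s D y - evolve M j t D y| ≤ j * |s - t| + (L + 2 * j * √T) * √|s - t| := by
  have aux : ∀ a b : ℝ, 0 ≤ a → a ≤ b → a ≤ T →
      |evolve M j b D y - evolve M j a D y| ≤ j * |b - a| + (L + 2 * j * √T) * √|b - a| := by
    intro a b ha hab haT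
    have := abs_evolve_add_sub_le h hL hj ha (s := b - a) (by linarith) y
    rw [add_sub_cancel] at this
    rw [abs_of_nonneg (by linarith : 0 ≤ b - a)]
    refine this.trans ?_
    gcongr
  rcases le_total t s with hts | hts
  · exact aux t s ht hts hT
  · rw [abs_sub_comm, abs_sub_comm s t]
    exact aux s t hs hts hT'

/-- A function that is a limit, in the Lipschitz seminorm based at `x`, of functions differentiable at
`x` is differentiable at `x`. -/
theorem differentiableAt_of_approx {f : ℝ → ℝ} {x : ℝ}
    (h : ∀ ε > 0, ∃ (g : ℝ → ℝ) (g' : ℝ), HasDerivAt g g' x ∧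
      ∀ y, |(f y - g y) - (f x - g x)| ≤ ε * |y - x|) :
    DifferentiableAt ℝ f x := by
  choose! g g' hg hfg using fun n : ℕ => h (1 / ((n : ℝ) + 1)) (by positivity)
  -- the approximate derivatives form a Cauchy sequence
  have hlip : ∀ (ε : ℝ) (F : ℝ → ℝ) (F' : ℝ), HasDerivAt F F' x → 0 ≤ ε →
      (∀ y, |F y - F x| ≤ ε * |y - x|) → |F'| ≤ ε := by
    intro ε F F' hF hε hb
    have := hF.le_of_lip' hε (Eventually.of_forall fun y => hb y)
    simpa using this
  have hc : CauchySeq g' := by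
    refine cauchySeq_of_le_tendsto_0 (fun m : ℕ => 2 * (1 / ((m : ℝ) + 1)))
      (fun n m N hn hm => ?_) (tendsto_mul_one_div_add_atTop _)
    rw [Real.dist_eq]
    refine hlip _ _ _ ((hg n).sub (hg m)) (by positivity) fun y => ?_
    have h1 := hfg n y
    have h2 := hfg m y
    have e1 : 1 / ((n : ℝ) + 1) ≤ 1 / (N + 1) := by gcongr
    have e2 : 1 / ((m : ℝ) + 1) ≤ 1 / (N + 1) := by gcongr
    have e3 := mul_le_mul_of_nonneg_right e1 (abs_nonneg (y - x))
    have e4 := mul_le_mul_of_nonneg_right e2 (abs_nonneg (y - x))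
    simp only [Pi.sub_apply]
    rw [abs_le] at *
    constructor <;> linarith
  obtain ⟨d, hd⟩ := cauchySeq_tendsto_of_complete hc
  refine HasDerivAt.differentiableAt (f' := d) ?_
  rw [hasDerivAt_iff_isLittleO, Asymptotics.isLittleO_iff]
  intro c hc0
  obtain ⟨n, hn1, hn2⟩ : ∃ n : ℕ, 1 / ((n : ℝ) + 1) < c / 3 ∧ |g' n - d| < c / 3 := by
    have e1 := (tendsto_one_div_add_atTop_nhds_zero_nat (𝕜 := ℝ)).eventually
      (gt_mem_nhds (show (0 : ℝ) < c / 3 by positivity))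
    have e2 := (Metric.tendsto_nhds.1 hd) (c / 3) (by positivity)
    obtain ⟨n, hn⟩ := (e1.and e2).exists
    exact ⟨n, hn.1, by simpa [Real.dist_eq] using hn.2⟩
  have hgn := hg n
  rw [hasDerivAt_iff_isLittleO, Asymptotics.isLittleO_iff] at hgn
  filter_upwards [hgn (show 0 < c / 3 by positivity)] with y hy
  have h1 := hfg n y
  simp only [smul_eq_mul, Real.norm_eq_abs] at hy ⊢
  have h2 := mul_le_mul_of_nonneg_right hn1.le (abs_nonneg (y - x))
  have h3 : |(y - x) * (g' n - d)| ≤ c / 3 * |y - x| := by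
    rw [abs_mul, mul_comm]
    exact mul_le_mul_of_nonneg_right hn2.le (abs_nonneg _)
  have h4 : (y - x) * (g' n - d) = (y - x) * g' n - (y - x) * d := by ring
  rw [h4] at h3
  rw [abs_le] at *
  constructor <;> linarith

/-- The approximation of `evolve M j t D` by smoothing the last stretch of time `s`, in the Lipschitz
seminorm. -/
theorem evolve_approx (h : State M D) (hj : 0 ≤ j) {s : ℝ} (hs : 0 < s) (hst : s ≤ t) (x y : ℝ) :
    |(evolve M j t D y - gaussAvg s (evolve M j (t - s) D) y) -
      (evolve M j t D x - gaussAvg s (evolve M j (t - s) D) x)| ≤ 2 * j * √s * |y - x| := by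
  have := evolve_sub_gaussAvg_lipschitz (h.evolve hj (sub_nonneg.2 hst)) hj hs.le y x
  rwa [evolve_evolve h hj (sub_nonneg.2 hst) hs.le, sub_add_cancel] at this

theorem exists_small_sqrt (j : ℝ) (ht : 0 < t) {ε : ℝ} (hε : 0 < ε) :
    ∃ s, 0 < s ∧ s < t ∧ 2 * j * √s < ε := by
  have h1 : Tendsto (fun s : ℝ => 2 * j * √s) (𝓝[>] 0) (𝓝 0) := by
    have : Continuous fun s : ℝ => 2 * j * √s := by fun_prop
    simpa using (this.tendsto 0).mono_left nhdsWithin_le_nhds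
  obtain ⟨s, hs⟩ := ((h1.eventually (gt_mem_nhds hε)).and (Ioo_mem_nhdsGT ht)).exists
  exact ⟨s, hs.2.1, hs.2.2, hs.1⟩

theorem differentiableAt_evolve (h : State M D) (hj : 0 ≤ j) (ht : 0 < t) (x : ℝ) :
    DifferentiableAt ℝ (evolve M j t D) x := by
  refine differentiableAt_of_approx fun ε hε => ?_
  obtain ⟨s, hs, hst, hsε⟩ := exists_small_sqrt j ht hε
  have hE := h.evolve hj (sub_nonneg.2 hst.le)
  exact ⟨_, _, hasDerivAt_gaussAvg hE.meas hE.abs_le hs x, fun y =>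
    (evolve_approx h hj hs hst.le x y).trans (by gcongr)⟩

theorem abs_deriv_evolve_sub_gaussGrad_le (h : State M D) (hj : 0 ≤ j) {s : ℝ} (hs : 0 < s)
    (hst : s ≤ t) (x : ℝ) :
    |deriv (evolve M j t D) x - gaussGrad s (evolve M j (t - s) D) x| ≤ 2 * j * √s := by
  have hE := h.evolve hj (sub_nonneg.2 hst)
  have h1 := (differentiableAt_evolve h hj (hs.trans_le hst) x).hasDerivAt.sub
    (hasDerivAt_gaussAvg hE.meas hE.abs_le hs x)
  have := h1.le_of_lip' (C := 2 * j * √s) (by positivity)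
    (Eventually.of_forall fun y => evolve_approx h hj hs hst x y)
  simpa using this

theorem deriv_evolve_le (h : State M D) (hj : 0 ≤ j) (ht : 0 < t) (x : ℝ) :
    deriv (evolve M j t D) x ≤ M := by
  have h1 : Antitone fun y => evolve M j t D y - M * y := fun a b hab => by
    have := (h.evolve hj ht.le).slope a b hab
    show _ - _ ≤ _ - _
    linarith
  have h2 := h1.deriv_nonpos (x := x)
  have h3 := ((differentiableAt_evolve h hj ht x).hasDerivAt.sub
    ((hasDerivAt_id x).const_mul M)).deriv
  have h4 : deriv (fun y => evolve M j t D y - M * y) x = deriv (evolve M j t D) x - M * 1 := h3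
  linarith

/-- Joint continuity of the spatial derivative on positive times, as a local uniform limit of the
continuous functions `(x, t) ↦ gaussGrad s (evolve M j (t - s) D) x`. -/
theorem continuousOn_deriv_evolve (h : State M D) (hL : ∀ y y', |D y - D y'| ≤ L * |y - y'|)
    (hj : 0 ≤ j) :
    ContinuousOn (fun p : ℝ × ℝ => deriv (evolve M j p.2 D) p.1) (univ ×ˢ Ioi (0 : ℝ)) := by
  rintro ⟨x₀, t₀⟩ ⟨-, ht₀⟩
  rw [mem_Ioi] at ht₀
  refine ContinuousAt.continuousWithinAt ?_
  refine continuousAt_of_locally_uniform_approx_of_continuousAt fun U hU => ?_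
  obtain ⟨ε, hε, hεU⟩ := Metric.mem_uniformity_dist.1 hU
  obtain ⟨s, hs, hst, hsε⟩ := exists_small_sqrt j (half_pos ht₀) hε
  have hst2 : s < t₀ := by linarith
  have hnhds : {p : ℝ × ℝ | s < p.2 ∧ p.2 < t₀ + 1} ∈ 𝓝 ((x₀, t₀) : ℝ × ℝ) :=
    IsOpen.mem_nhds ((isOpen_lt continuous_const continuous_snd).inter
      (isOpen_lt continuous_snd continuous_const)) ⟨hst2, by simp⟩
  refine ⟨_, hnhds, fun p => gaussGrad s (evolve M j (p.2 - s) D) p.1, ?_, fun p hp => hεU ?_⟩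
  · -- the approximating gradient is continuous at `(x₀, t₀)`
    have hE := h.evolve hj (sub_nonneg.2 hst2.le)
    have hb : ∀ p : ℝ × ℝ, s < p.2 ∧ p.2 < t₀ + 1 →
        dist (gaussGrad s (evolve M j (p.2 - s) D) p.1)
          (gaussGrad s (evolve M j (t₀ - s) D) x₀) ≤
        (j * |p.2 - t₀| + (L + 2 * j * √(t₀ + 1)) * √|p.2 - t₀|) / √s +
          2 * M / s * |p.1 - x₀| := by
      intro p hp
      have hE' := h.evolve hj (sub_nonneg.2 hp.1.le)
      rw [Real.dist_eq]
      refine (abs_sub_le _ (gaussGrad s (evolve M j (t₀ - s) D) p.1) _).trans (add_le_add ?_ ?_)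
      · refine abs_gaussGrad_sub_le hE'.meas hE'.abs_le hE.meas hE.abs_le hs _ _ fun z => ?_
        have := abs_evolve_sub_evolve_le h hL hj (sub_nonneg.2 hst2.le) (sub_nonneg.2 hp.1.le)
          (T := t₀ + 1) (by linarith) (by linarith [hp.2]) (p.1 + z)
        rwa [sub_sub_sub_cancel_right] at this
      · exact gaussGrad_lipschitz hE.meas hE.abs_le hs _ _
    have hlim : Tendsto (fun p : ℝ × ℝ =>
        (j * |p.2 - t₀| + (L + 2 * j * √(t₀ + 1)) * √|p.2 - t₀|) / √s +
          2 * M / s * |p.1 - x₀|) (𝓝 (x₀, t₀)) (𝓝 0) := by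
      have : Continuous fun p : ℝ × ℝ =>
        (j * |p.2 - t₀| + (L + 2 * j * √(t₀ + 1)) * √|p.2 - t₀|) / √s +
          2 * M / s * |p.1 - x₀| := by fun_prop
      simpa using this.tendsto (x₀, t₀)
    refine tendsto_iff_dist_tendsto_zero.2 (squeeze_zero' (Eventually.of_forall fun _ => dist_nonneg)
      ?_ hlim)
    filter_upwards [hnhds] with p hp using hb p hp
  · rw [Real.dist_eq]
    exact (abs_deriv_evolve_sub_gaussGrad_le h hj hs hp.1.le p.1).trans_lt hsε

end Regularity

end Evolution

/-! ### Measures on the interval and the Neumann heat kernel -/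

section Measures

/-- The deviation, at `y`, of the unit mass at `x ∈ [0, 1)`. With `y` subtracted it is a step function
that jumps by `-1` at each of the images `2k + x` and `2k - x`. -/
def sawtooth (y x : ℝ) : ℝ := Int.fract ((x + y) / 2) - Int.fract ((x - y) / 2)

theorem measurable_sawtooth : Measurable fun p : ℝ × ℝ => sawtooth p.1 p.2 :=
  (measurable_fract.comp ((measurable_snd.add measurable_fst).div_const 2)).sub
    (measurable_fract.comp ((measurable_snd.sub measurable_fst).div_const 2))

theorem measurable_sawtooth_left (x : ℝ) : Measurable fun y => sawtooth y x :=
  measurable_sawtooth.comp (measurable_id.prodMk measurable_const)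

theorem measurable_sawtooth_right (y : ℝ) : Measurable (sawtooth y) :=
  measurable_sawtooth.comp (measurable_const.prodMk measurable_id)

theorem abs_sawtooth_le (y x : ℝ) : |sawtooth y x| ≤ 1 := by
  unfold sawtooth
  have h1 := Int.fract_nonneg ((x + y) / 2)
  have h2 := Int.fract_lt_one ((x + y) / 2)
  have h3 := Int.fract_nonneg ((x - y) / 2)
  have h4 := Int.fract_lt_one ((x - y) / 2)
  rw [abs_le]
  constructor <;> linarith

theorem sawtooth_eq (y x : ℝ) : sawtooth y x = y + (⌊(x - y) / 2⌋ - ⌊(x + y) / 2⌋ : ℝ) := by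
  unfold sawtooth Int.fract
  ring

theorem oddPer_sawtooth (x : ℝ) : OddPer fun y => sawtooth y x where
  odd y := by
    simp only [sawtooth, sub_neg_eq_add, ← sub_eq_add_neg, neg_sub]
  per y := by
    have h1 : Int.fract ((x + (y + 2)) / 2) = Int.fract ((x + y) / 2) := by
      rw [show (x + (y + 2)) / 2 = (x + y) / 2 + 1 by ring, Int.fract_add_one]
    have h2 : Int.fract ((x - (y + 2)) / 2) = Int.fract ((x - y) / 2) := by
      rw [show (x - (y + 2)) / 2 = (x - y) / 2 - 1 by ring, Int.fract_sub_one]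
    simp only [sawtooth, h1, h2]
  meas := measurable_sawtooth_left x
  bdd := ⟨1, fun y => abs_sawtooth_le y x⟩

theorem sawtooth_slope (x : ℝ) {y y' : ℝ} (h : y ≤ y') :
    sawtooth y' x - sawtooth y x ≤ y' - y := by
  have h1 : (⌊(x - y') / 2⌋ : ℝ) ≤ ⌊(x - y) / 2⌋ := by
    exact_mod_cast Int.floor_le_floor (by linarith)
  have h2 : (⌊(x + y) / 2⌋ : ℝ) ≤ ⌊(x + y') / 2⌋ := by
    exact_mod_cast Int.floor_le_floor (by linarith)
  rw [sawtooth_eq, sawtooth_eq]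
  linarith

theorem sawtooth_of_mem {r x : ℝ} (hr : r ∈ Icc (0 : ℝ) 1) (hx : x ∈ Ico (0 : ℝ) 1) :
    sawtooth r x = (Icc r 1).indicator (fun _ => 1) x - (1 - r) := by
  have h1 : ⌊(x + r) / 2⌋ = 0 :=
    Int.floor_eq_zero_iff.2 ⟨by linarith [hr.1, hx.1], by linarith [hr.2, hx.2]⟩
  rw [sawtooth_eq, h1]
  rcases le_or_gt r x with h | h
  · have h2 : ⌊(x - r) / 2⌋ = 0 :=
      Int.floor_eq_zero_iff.2 ⟨by linarith, by linarith [hr.1, hx.2]⟩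
    rw [h2, indicator_of_mem (show x ∈ Icc r 1 from ⟨h, hx.2.le⟩)]
    simp
  · have h2 : ⌊(x - r) / 2⌋ = -1 := by
      rw [Int.floor_eq_iff]
      push_cast
      constructor <;> linarith [hr.2, hx.1]
    rw [h2, indicator_of_notMem (fun hm : x ∈ Icc r 1 => absurd hm.1 (not_le.2 h))]
    push_cast
    ring

/-- `μ` lives on `[0, 1]`, has mass `M` and no atom at `1`, so that its tail function vanishes at `1`. -/
structure MassOn (M : ℝ) (μ : Measure ℝ) : Prop where
  nonneg : 0 ≤ M
  mass : μ univ = ENNReal.ofReal M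
  compl : μ (Icc (0 : ℝ) 1)ᶜ = 0
  one : μ {1} = 0

/-- The deviation of `μ`: for `y ∈ [0, 1]` it is `μ [y, 1] - M (1 - y)`, and superposing `sawtooth`
gives its odd periodic extension at once. -/
def deviation (μ : Measure ℝ) (y : ℝ) : ℝ := ∫ x, sawtooth y x ∂μ

variable {M : ℝ} {μ : Measure ℝ}

namespace MassOn

theorem finite (h : MassOn M μ) : IsFiniteMeasure μ :=
  ⟨by rw [h.mass]; exact ENNReal.ofReal_lt_top⟩

theorem real_univ (h : MassOn M μ) : μ.real univ = M := by
  rw [Measure.real, h.mass, ENNReal.toReal_ofReal h.nonneg]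

theorem ae_mem (h : MassOn M μ) : ∀ᵐ x ∂μ, x ∈ Ico (0 : ℝ) 1 := by
  have h1 : ∀ᵐ x ∂μ, x ∈ Icc (0 : ℝ) 1 := h.compl
  have h2 : ∀ᵐ x ∂μ, x ≠ 1 := by
    rw [ae_iff]
    simpa using h.one
  filter_upwards [h1, h2] with x hx hx1
  exact ⟨hx.1, lt_of_le_of_ne hx.2 hx1⟩

theorem integrable_sawtooth (h : MassOn M μ) (y : ℝ) : Integrable (sawtooth y) μ := by
  have := h.finite
  exact Integrable.of_bound (measurable_sawtooth_right y).aestronglyMeasurable 1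
    (ae_of_all _ fun x => abs_sawtooth_le y x)

theorem state (h : MassOn M μ) : State M (deviation μ) where
  odd y := by
    unfold deviation
    rw [← integral_neg]
    exact integral_congr_ae (ae_of_all _ fun x => (oddPer_sawtooth x).odd y)
  per y := integral_congr_ae (ae_of_all _ fun x => (oddPer_sawtooth x).per y)
  meas := by
    have := h.finite
    exact (measurable_sawtooth.stronglyMeasurable.integral_prod_right (ν := μ)).measurable
  bdd := by
    have := h.finite
    refine ⟨M, fun y => ?_⟩
    have := norm_integral_le_of_norm_le_const (μ := μ) (f := sawtooth y) (C := 1)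
      (ae_of_all _ fun x => abs_sawtooth_le y x)
    rwa [one_mul, h.real_univ] at this
  slope y y' hy := by
    have := h.finite
    unfold deviation
    rw [← integral_sub (h.integrable_sawtooth y') (h.integrable_sawtooth y)]
    calc _ ≤ ∫ _, (y' - y) ∂μ :=
          integral_mono ((h.integrable_sawtooth y').sub (h.integrable_sawtooth y))
            (integrable_const _) fun x => sawtooth_slope x hy
      _ = M * (y' - y) := by rw [integral_const, h.real_univ, smul_eq_mul]

theorem deviation_eq (h : MassOn M μ) {r : ℝ} (hr : r ∈ Icc (0 : ℝ) 1) :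
    deviation μ r = μ.real (Icc r 1) - M * (1 - r) := by
  have := h.finite
  have h1 : deviation μ r = ∫ x, ((Icc r 1).indicator (fun _ => (1 : ℝ)) x - (1 - r)) ∂μ := by
    refine integral_congr_ae ?_
    filter_upwards [h.ae_mem] with x hx using sawtooth_of_mem hr hx
  rw [h1, integral_sub ((integrable_const _).indicator measurableSet_Icc) (integrable_const _),
    integral_indicator measurableSet_Icc, integral_const, integral_const, h.real_univ]
  simp

theorem tail_eq (h : MassOn M μ) {r : ℝ} (hr : r ∈ Icc (0 : ℝ) 1) :
    μ (Icc r 1) = ENNReal.ofReal (deviation μ r + M * (1 - r)) := by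
  have := h.finite
  rw [h.deviation_eq hr, sub_add_cancel, ofReal_measureReal]

theorem deviation_eq_of_tail (h : MassOn M μ) {D : ℝ → ℝ} (hD : State M D)
    (ht : ∀ r ∈ Icc (0 : ℝ) 1, μ (Icc r 1) = ENNReal.ofReal (D r + M * (1 - r))) :
    deviation μ = D := by
  refine h.state.toOddPer.ext01 hD.toOddPer fun r hr => ?_
  rw [h.deviation_eq hr, Measure.real, ht r hr, ENNReal.toReal_ofReal (hD.tail_nonneg hr.2)]
  ring

/-- A measure on `[0, 1]` is recognised by its tails. -/
theorem of_tail {D : ℝ → ℝ} (hD : State M D) (hc : μ (Icc (0 : ℝ) 1)ᶜ = 0)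
    (ht : ∀ r ∈ Icc (0 : ℝ) 1, μ (Icc r 1) = ENNReal.ofReal (D r + M * (1 - r))) :
    MassOn M μ ∧ deviation μ = D := by
  have h : MassOn M μ := by
    refine ⟨hD.mass_nonneg, ?_, hc, ?_⟩
    · rw [← measure_add_measure_compl (measurableSet_Icc (a := (0 : ℝ)) (b := 1)), hc, add_zero,
        ht 0 ⟨le_rfl, zero_le_one⟩, hD.zero]
      simp
    · have := ht 1 ⟨zero_le_one, le_rfl⟩
      rw [hD.one] at this
      simpa using this
  exact ⟨h, h.deviation_eq_of_tail hD ht⟩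

end MassOn

section Kernel

variable {t : ℝ}

theorem gaussKernel_nonneg (t r r' : ℝ) : 0 ≤ gaussKernel t r r' := by
  unfold gaussKernel
  positivity

theorem gaussKernel_eq_pdf (ht : 0 < t) (r c : ℝ) :
    gaussKernel t r c = gaussianPDFReal c t.toNNReal r := by
  rw [gaussKernel, gaussianPDFReal, Real.coe_toNNReal t ht.le, div_eq_inv_mul]

theorem measurable_gaussKernel (t : ℝ) : Measurable fun p : ℝ × ℝ => gaussKernel t p.1 p.2 := by
  unfold gaussKernel
  fun_prop

/-- Summability over the images, so that the `tsum` in `neumannKernel` is a genuine sum. -/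
theorem summable_gaussKernel (ht : 0 < t) (r c : ℝ) :
    Summable fun k : ℤ => gaussKernel t r (2 * (k : ℝ) + c) := by
  have hT : 0 < 2 / (Real.pi * t) := by positivity
  have h := summable_pow_mul_jacobiTheta₂_term_bound (|r - c| / (Real.pi * t)) hT 0
  refine Summable.of_nonneg_of_le (fun k => gaussKernel_nonneg _ _ _) (fun k => ?_)
    (h.mul_left (1 / √(2 * Real.pi * t)))
  rw [pow_zero, one_mul, gaussKernel, div_eq_inv_mul, one_div]
  have hle : -(r - (2 * (k : ℝ) + c)) ^ 2 / (2 * t) ≤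
      -Real.pi * (2 / (Real.pi * t) * (k : ℝ) ^ 2 - 2 * (|r - c| / (Real.pi * t)) * |(k : ℝ)|) := by
    have e : -Real.pi * (2 / (Real.pi * t) * (k : ℝ) ^ 2 -
        2 * (|r - c| / (Real.pi * t)) * |(k : ℝ)|) - -(r - (2 * (k : ℝ) + c)) ^ 2 / (2 * t) =
        (4 * (|r - c| * |(k : ℝ)| - (r - c) * k) + (r - c) ^ 2) / (2 * t) := by
      field_simp
      ring
    have h1 : (r - c) * k ≤ |r - c| * |(k : ℝ)| := by
      rw [← abs_mul]
      exact le_abs_self _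
    have : 0 ≤ (4 * (|r - c| * |(k : ℝ)| - (r - c) * k) + (r - c) ^ 2) / (2 * t) := by
      apply div_nonneg _ (by positivity)
      nlinarith [sq_nonneg (r - c)]
    linarith
  push_cast
  gcongr

theorem ofReal_neumannKernel (ht : 0 < t) (r x : ℝ) :
    ENNReal.ofReal (neumannKernel t r x) =
      ∑' k : ℤ, (ENNReal.ofReal (gaussKernel t r (2 * (k : ℝ) + x)) +
        ENNReal.ofReal (gaussKernel t r (2 * (k : ℝ) - x))) := by
  have h1 := summable_gaussKernel ht r x
  have h2 := summable_gaussKernel ht r (-x)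
  simp only [← sub_eq_add_neg] at h2
  rw [neumannKernel, ENNReal.ofReal_tsum_of_nonneg
    (fun k => add_nonneg (gaussKernel_nonneg _ _ _) (gaussKernel_nonneg _ _ _)) (h1.add h2)]
  exact tsum_congr fun k => ENNReal.ofReal_add (gaussKernel_nonneg _ _ _) (gaussKernel_nonneg _ _ _)

theorem measurable_ofReal_neumannKernel (ht : 0 < t) :
    Measurable fun p : ℝ × ℝ => ENNReal.ofReal (neumannKernel t p.1 p.2) := by
  simp only [ofReal_neumannKernel ht]
  refine Measurable.tsum fun k => ?_
  exact (((measurable_gaussKernel t).comp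
    (measurable_fst.prodMk (measurable_snd.const_add _))).ennreal_ofReal).add
    (((measurable_gaussKernel t).comp
    (measurable_fst.prodMk (measurable_snd.const_sub _))).ennreal_ofReal)

theorem lintegral_gaussKernel (ht : 0 < t) (c : ℝ) {s : Set ℝ} (hs : MeasurableSet s) :
    ∫⁻ y in s, ENNReal.ofReal (gaussKernel t y c) =
      ∫⁻ z, s.indicator (fun _ => 1) (c - z) ∂(gaussianReal 0 t.toNNReal) := by
  have h1 : ∫⁻ y in s, ENNReal.ofReal (gaussKernel t y c) = gaussianReal c t.toNNReal s := by
    rw [gaussianReal_apply _ (toNNReal_ne_zero ht)]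
    simp only [gaussKernel_eq_pdf ht]
    rfl
  have hm : Measurable fun z : ℝ => c - z := measurable_const.sub measurable_id
  have h2 : gaussianReal c t.toNNReal = (gaussianReal 0 t.toNNReal).map (c - ·) := by
    rw [gaussianReal_map_const_sub, sub_zero]
  rw [h1, h2, ← lintegral_indicator_one hs, lintegral_map (measurable_one.indicator hs) hm]
  rfl

theorem tsum_indicator_Ioc {a b : ℝ} (hab : a ≤ b) :
    ∑' k : ℤ, (Ioc a b).indicator (fun _ => (1 : ℝ≥0∞)) (k : ℝ) =
      ENNReal.ofReal (⌊b⌋ - ⌊a⌋ : ℝ) := by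
  have h : ∀ k : ℤ, (k : ℝ) ∈ Ioc a b ↔ k ∈ Finset.Ioc ⌊a⌋ ⌊b⌋ := fun k => by
    rw [Finset.mem_Ioc, Int.floor_lt, Int.le_floor, mem_Ioc]
  rw [tsum_eq_sum (s := Finset.Ioc ⌊a⌋ ⌊b⌋) fun k hk =>
    indicator_of_notMem (fun hm => hk ((h k).1 hm)) _,
    Finset.sum_congr rfl fun k hk => indicator_of_mem ((h k).2 hk) _]
  have hle : ⌊a⌋ ≤ ⌊b⌋ := Int.floor_le_floor hab
  simp only [Finset.sum_const, Int.card_Ioc, nsmul_eq_mul, mul_one]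
  rw [← ENNReal.ofReal_natCast]
  congr 1
  rw [← Int.cast_natCast, Int.toNat_of_nonneg (sub_nonneg.2 hle)]
  push_cast
  rfl

/-- For a displacement `z`, the images that `-z` carries into `[r, 1]` are counted by the difference of
`sawtooth` at `r + z` and `1 + z`, up to its linear part. The half-open intervals are those matching
`Int.floor`. -/
theorem tsum_images {r : ℝ} (hr : r ≤ 1) (x z : ℝ) :
    ∑' k : ℤ, ((Ico r 1).indicator (fun _ => (1 : ℝ≥0∞)) (2 * (k : ℝ) + x - z) +
        (Ioc r 1).indicator (fun _ => (1 : ℝ≥0∞)) (2 * (k : ℝ) - x - z)) =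
      ENNReal.ofReal (sawtooth (r + z) x - sawtooth (1 + z) x + (1 - r)) := by
  rw [ENNReal.tsum_add]
  have h1 : ∑' k : ℤ, (Ico r 1).indicator (fun _ => (1 : ℝ≥0∞)) (2 * (k : ℝ) + x - z) =
      ENNReal.ofReal (⌊(x - (r + z)) / 2⌋ - ⌊(x - (1 + z)) / 2⌋ : ℝ) := by
    rw [← tsum_indicator_Ioc (by linarith), ← (Equiv.neg ℤ).tsum_eq]
    refine tsum_congr fun k => ?_
    simp only [indicator, Equiv.neg_apply, Int.cast_neg, mem_Ico, mem_Ioc]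
    congr 1
    rw [eq_iff_iff]
    constructor <;> rintro ⟨p, q⟩ <;> constructor <;> linarith
  have h2 : ∑' k : ℤ, (Ioc r 1).indicator (fun _ => (1 : ℝ≥0∞)) (2 * (k : ℝ) - x - z) =
      ENNReal.ofReal (⌊(x + (1 + z)) / 2⌋ - ⌊(x + (r + z)) / 2⌋ : ℝ) := by
    rw [← tsum_indicator_Ioc (by linarith)]
    refine tsum_congr fun k => ?_
    simp only [indicator, mem_Ioc]
    congr 1
    rw [eq_iff_iff]
    constructor <;> rintro ⟨p, q⟩ <;> constructor <;> linarith
  have f1 : (⌊(x - (1 + z)) / 2⌋ : ℝ) ≤ ⌊(x - (r + z)) / 2⌋ := by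
    exact_mod_cast Int.floor_le_floor (by linarith)
  have f2 : (⌊(x + (r + z)) / 2⌋ : ℝ) ≤ ⌊(x + (1 + z)) / 2⌋ := by
    exact_mod_cast Int.floor_le_floor (by linarith)
  rw [h1, h2, ← ENNReal.ofReal_add (by linarith) (by linarith), sawtooth_eq, sawtooth_eq]
  congr 1
  ring

/-- The mass that the Neumann kernel started at `x` puts on `[r, 1]`: the deviation of the unit mass at
`x` evolves by the Gaussian average. -/
theorem lintegral_neumannKernel (ht : 0 < t) {r : ℝ} (hr : r ≤ 1) (x : ℝ) :
    ∫⁻ y in Icc r 1, ENNReal.ofReal (neumannKernel t y x) =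
      ENNReal.ofReal (gaussAvg t (fun y => sawtooth y x) r + (1 - r)) := by
  have hmeas : ∀ c : ℝ, Measurable fun y => ENNReal.ofReal (gaussKernel t y c) := fun c =>
    ((measurable_gaussKernel t).comp (measurable_id.prodMk measurable_const)).ennreal_ofReal
  have hind : ∀ (c : ℝ) {s : Set ℝ}, MeasurableSet s →
      Measurable fun z : ℝ => s.indicator (fun _ => (1 : ℝ≥0∞)) (c - z) := fun c s hs =>
    (measurable_const.indicator hs).comp (measurable_const.sub measurable_id)
  have e1 : ∫⁻ y in Icc r 1, ENNReal.ofReal (neumannKernel t y x) =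
      ∑' k : ℤ, ((∫⁻ y in Ico r 1, ENNReal.ofReal (gaussKernel t y (2 * (k : ℝ) + x))) +
        ∫⁻ y in Ioc r 1, ENNReal.ofReal (gaussKernel t y (2 * (k : ℝ) - x))) := by
    have hm : ∀ k : ℤ, AEMeasurable (fun y => ENNReal.ofReal (gaussKernel t y (2 * (k : ℝ) + x)) +
        ENNReal.ofReal (gaussKernel t y (2 * (k : ℝ) - x))) (volume.restrict (Icc r 1)) :=
      fun k => ((hmeas _).add (hmeas _)).aemeasurable
    simp only [ofReal_neumannKernel ht]
    rw [lintegral_tsum hm]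
    refine tsum_congr fun k => ?_
    rw [lintegral_add_left (hmeas _), setLIntegral_congr Ico_ae_eq_Icc,
      setLIntegral_congr Ioc_ae_eq_Icc]
  have e2 : ∫⁻ y in Icc r 1, ENNReal.ofReal (neumannKernel t y x) =
      ∫⁻ z, ENNReal.ofReal (sawtooth (r + z) x - sawtooth (1 + z) x + (1 - r))
        ∂(gaussianReal 0 t.toNNReal) := by
    rw [e1]
    simp only [lintegral_gaussKernel ht _ measurableSet_Ico,
      lintegral_gaussKernel ht _ measurableSet_Ioc, ← tsum_images hr]
    have hm : ∀ k : ℤ, AEMeasurable (fun z =>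
        (Ico r 1).indicator (fun _ => (1 : ℝ≥0∞)) (2 * (k : ℝ) + x - z) +
        (Ioc r 1).indicator (fun _ => (1 : ℝ≥0∞)) (2 * (k : ℝ) - x - z))
        (gaussianReal 0 t.toNNReal) :=
      fun k => ((hind _ measurableSet_Ico).add (hind _ measurableSet_Ioc)).aemeasurable
    rw [lintegral_tsum hm]
    exact tsum_congr fun k => (lintegral_add_left (hind _ measurableSet_Ico) _).symm
  have hO := oddPer_sawtooth x
  have i1 := integrable_shift hO.meas (fun y => abs_sawtooth_le y x) t r
  have i2 := integrable_shift hO.meas (fun y => abs_sawtooth_le y x) t 1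
  have i3 : Integrable (fun z => sawtooth (r + z) x - sawtooth (1 + z) x)
    (gaussianReal 0 t.toNNReal) := i1.sub i2
  have i4 : Integrable (fun z => sawtooth (r + z) x - sawtooth (1 + z) x + (1 - r))
    (gaussianReal 0 t.toNNReal) := i3.add (integrable_const _)
  rw [e2, ← ofReal_integral_eq_lintegral_ofReal i4]
  · congr 1
    rw [integral_add i3 (integrable_const _), integral_sub i1 i2]
    -- the average of an odd periodic function vanishes at `1`
    have h1 : ∫ z, sawtooth (1 + z) x ∂(gaussianReal 0 t.toNNReal) = 0 := (hO.gaussAvg t).one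
    rw [h1]
    simp [gaussAvg]
  · refine ae_of_all _ fun z => ?_
    have := sawtooth_slope x (show r + z ≤ 1 + z by linarith)
    show 0 ≤ sawtooth (r + z) x - sawtooth (1 + z) x + (1 - r)
    linarith

theorem MassOn.heat_tail (h : MassOn M μ) (ht : 0 < t) {r : ℝ} (hr : r ∈ Icc (0 : ℝ) 1) :
    neumannHeat t μ (Icc r 1) =
      ENNReal.ofReal (gaussAvg t (deviation μ) r + M * (1 - r)) := by
  have := h.finite
  have hint : Integrable (fun p : ℝ × ℝ => sawtooth (r + p.2) p.1)
      (μ.prod (gaussianReal 0 t.toNNReal)) :=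
    Integrable.of_bound (measurable_sawtooth.comp
      ((measurable_snd.const_add r).prodMk measurable_fst)).aestronglyMeasurable 1
      (ae_of_all _ fun p => abs_sawtooth_le _ _)
  have hi : Integrable (fun x => gaussAvg t (fun y => sawtooth y x) r) μ := hint.integral_prod_left
  have hi' : Integrable (fun x => gaussAvg t (fun y => sawtooth y x) r + (1 - r)) μ :=
    hi.add (integrable_const _)
  rw [neumannHeat, withDensity_apply _ measurableSet_Icc, Measure.restrict_restrict measurableSet_Icc,
    inter_eq_left.2 (Icc_subset_Icc_left hr.1),
    lintegral_lintegral_swap (measurable_ofReal_neumannKernel ht).aemeasurable]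
  simp only [lintegral_neumannKernel ht hr.2]
  rw [← ofReal_integral_eq_lintegral_ofReal hi']
  · congr 1
    rw [integral_add hi (integrable_const _)]
    congr 1
    · exact integral_integral_swap hint
    · rw [integral_const, h.real_univ, smul_eq_mul]
  · refine ae_of_all _ fun x => ?_
    have := gaussAvg_slope (oddPer_sawtooth x).meas (fun y => abs_sawtooth_le y x) (M := 1)
      (fun y y' hy => by rw [one_mul]; exact sawtooth_slope x hy) t hr.2
    rw [((oddPer_sawtooth x).gaussAvg t).one] at this
    show 0 ≤ gaussAvg t (fun y => sawtooth y x) r + (1 - r)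
    linarith

/-- The Neumann heat flow of a measure is the Gaussian average of its deviation. -/
theorem MassOn.heat (h : MassOn M μ) (ht : 0 < t) :
    MassOn M (neumannHeat t μ) ∧ deviation (neumannHeat t μ) = gaussAvg t (deviation μ) := by
  refine MassOn.of_tail (h.state.gaussAvg t) ?_ fun r hr => h.heat_tail ht hr
  refine withDensity_absolutelyContinuous _ _ ?_
  rw [Measure.restrict_apply measurableSet_Icc.compl, compl_inter_self, measure_empty]

theorem neumannHeat_absolutelyContinuous (t : ℝ) (μ : Measure ℝ) : neumannHeat t μ ≪ volume :=
  (withDensity_absolutelyContinuous _ _).trans Measure.restrict_le_self.absolutelyContinuous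

end Kernel

end Measures

/-! ### Barriers of a profile and the separating function -/

section Profiles

variable {M j δ : ℝ} {μ ν : Measure ℝ}

section CutPasteMeasure

theorem MassOn.continuousOn_tail (h : MassOn M μ) (hac : μ ≪ volume) :
    ContinuousOn (fun r => deviation μ r + M * (1 - r)) (Icc 0 1) := by
  have := h.finite
  have : NullSingletonClass μ := ⟨fun x => hac (measure_singleton x)⟩
  have h1 : Continuous fun b : ℝ => ∫ _ in b..1, (1 : ℝ) ∂μ := by
    simp only [intervalIntegral.integral_symm 1]
    exact (intervalIntegral.continuous_primitive
      (fun a b => (integrable_const (1 : ℝ)).intervalIntegrable) 1).neg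
  refine h1.continuousOn.congr fun r hr => ?_
  show deviation μ r + M * (1 - r) = ∫ _ in r..1, (1 : ℝ) ∂μ
  rw [h.deviation_eq hr, sub_add_cancel, intervalIntegral.integral_of_le hr.2,
    ← integral_Icc_eq_integral_Ioc]
  simp

/-- For a measure without atoms the infimum in `cutPoint` is attained, and exactly the mass `j δ` lies
to the right of it. -/
theorem MassOn.cutPoint_spec (h : MassOn M μ) (hac : μ ≪ volume) (hpos : 0 < j * δ)
    (hlt : j * δ < M) : cutPoint j δ μ ∈ Ioo (0 : ℝ) 1 ∧
      deviation μ (cutPoint j δ μ) + M * (1 - cutPoint j δ μ) = j * δ := by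
  have hs := h.state
  have hcont := h.continuousOn_tail hac
  set F : ℝ → ℝ := fun r => deviation μ r + M * (1 - r) with hF
  have F0 : F 0 = M := by simp [hF, hs.zero]
  have F1 : F 1 = 0 := by simp [hF, hs.one]
  have hS : {r : ℝ | r ∈ Icc (0 : ℝ) 1 ∧ tailMass r μ = ENNReal.ofReal (j * δ)} =
      Icc (0 : ℝ) 1 ∩ F ⁻¹' {j * δ} := by
    ext r
    simp only [mem_ofPred_eq, mem_inter_iff, mem_preimage, mem_singleton_iff]
    refine and_congr_right fun hr => ?_
    rw [tailMass, h.tail_eq hr, ENNReal.ofReal_eq_ofReal_iff (hs.tail_nonneg hr.2) hpos.le]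
  have hne : (Icc (0 : ℝ) 1 ∩ F ⁻¹' {j * δ}).Nonempty := by
    have := intermediate_value_Icc' (zero_le_one' ℝ) hcont
    rw [F0, F1] at this
    obtain ⟨r, hr, hrF⟩ := this ⟨hpos.le, hlt.le⟩
    exact ⟨r, hr, hrF⟩
  have hcl : IsClosed (Icc (0 : ℝ) 1 ∩ F ⁻¹' {j * δ}) :=
    hcont.preimage_isClosed_of_isClosed isClosed_Icc isClosed_singleton
  have hmem : cutPoint j δ μ ∈ Icc (0 : ℝ) 1 ∩ F ⁻¹' {j * δ} := by
    rw [cutPoint, hS]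
    exact hcl.csInf_mem hne (bddBelow_Icc.mono inter_subset_left)
  have hval : F (cutPoint j δ μ) = j * δ := hmem.2
  refine ⟨⟨hmem.1.1.lt_of_ne' fun h0 => ?_, hmem.1.2.lt_of_ne fun h1 => ?_⟩, hval⟩
  · rw [h0, F0] at hval; linarith
  · rw [h1, F1] at hval; linarith

/-- The operator `K^(δ)` acts on deviations as `cut M (j δ)`. -/
theorem MassOn.cutPaste (h : MassOn M μ) (hac : μ ≪ volume) (hpos : 0 < j * δ)
    (hlt : j * δ < M) : MassOn M (cutPaste j δ μ) ∧
      deviation (cutPaste j δ μ) = cut M (j * δ) (deviation μ) := by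
  have := h.finite
  have : NullSingletonClass μ := ⟨fun x => hac (measure_singleton x)⟩
  have hs := h.state
  obtain ⟨hR, hFR⟩ := h.cutPoint_spec hac hpos hlt
  set R := cutPoint j δ μ with hRdef
  have hR' : R ∈ Icc (0 : ℝ) 1 := ⟨hR.1.le, hR.2.le⟩
  have happ : ∀ s, MeasurableSet s → CutPaste.cutPaste j δ μ s =
      ENNReal.ofReal (j * δ) * s.indicator 1 (0 : ℝ) + μ (s ∩ Icc 0 R) := fun s hms => by
    rw [CutPaste.cutPaste, Measure.add_apply, Measure.smul_apply, Measure.dirac_apply' _ hms,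
      Measure.restrict_apply hms, smul_eq_mul]
  -- the mass kept in `[r, R]`
  have hkeep : ∀ r ∈ Icc (0 : ℝ) R, μ (Icc r R) =
      ENNReal.ofReal (deviation μ r + M * (1 - r) - j * δ) := fun r hr => by
    have hr1 : r ∈ Icc (0 : ℝ) 1 := ⟨hr.1, hr.2.trans hR.2.le⟩
    have e : μ (Icc r 1) = μ (Icc r R) + μ (Icc R 1) := by
      rw [← Icc_union_Icc_eq_Icc hr.2 hR.2.le]
      refine measure_union₀ measurableSet_Icc.nullMeasurableSet ?_
      rw [AEDisjoint, Icc_inter_Icc_eq_singleton hr.2 hR.2.le]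
      exact measure_singleton R
    rw [h.tail_eq hr1, h.tail_eq hR', hFR] at e
    rw [ENNReal.ofReal_sub _ hpos.le, e, ENNReal.add_sub_cancel_right ENNReal.ofReal_ne_top]
  refine MassOn.of_tail (hs.cut hpos.le) ?_ fun r hr => ?_
  · rw [happ _ measurableSet_Icc.compl, indicator_of_notMem (by simp), mul_zero, zero_add]
    exact measure_mono_null inter_subset_left h.compl
  · rw [happ _ measurableSet_Icc]
    rcases hr.1.eq_or_lt with rfl | h0
    · rw [indicator_of_mem (by simp), inter_eq_right.2 (Icc_subset_Icc_right hR.2.le),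
        hkeep 0 ⟨le_rfl, hR.1.le⟩, hs.zero, (hs.cut hpos.le).zero, Pi.one_apply, mul_one,
        ← ENNReal.ofReal_add hpos.le (by linarith)]
      congr 1
      ring
    · rw [indicator_of_notMem (fun hm : (0 : ℝ) ∈ Icc r 1 => absurd hm.1 (not_le.2 h0)), mul_zero,
        zero_add, tail_cut hs hpos.le ⟨h0, hr.2⟩, Icc_inter_Icc, max_eq_left hr.1,
        min_eq_right hR.2.le]
      rcases le_or_gt r R with hrR | hrR
      · rw [hkeep r ⟨hr.1, hrR⟩, ENNReal.ofReal_max, ENNReal.ofReal_zero, max_eq_left zero_le]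
      · rw [Icc_eq_empty (not_le.2 hrR), measure_empty, max_eq_right, ENNReal.ofReal_zero]
        have := hs.slope R r hrR.le
        linarith

end CutPasteMeasure

section Profile

variable {u v : ℝ → ℝ}

theorem IsProfile.integrableOn (hu : IsProfile u) : IntegrableOn u (Icc 0 1) :=
  hu.1.integrable le_top

theorem IsProfile.tail (hu : IsProfile u) {r : ℝ} (hr : 0 ≤ r) :
    profileMeasure u (Icc r 1) = ENNReal.ofReal (∫ x in Icc r 1, u x) := by
  have hsub : Icc r 1 ⊆ Icc 0 1 := Icc_subset_Icc_left hr
  rw [profileMeasure, withDensity_apply _ measurableSet_Icc,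
    Measure.restrict_restrict measurableSet_Icc, inter_eq_left.2 hsub,
    ofReal_integral_eq_lintegral_ofReal (hu.integrableOn.mono_set hsub)
      (ae_restrict_of_ae_restrict_of_subset hsub hu.2)]

theorem profileMeasure_compl (u : ℝ → ℝ) : profileMeasure u (Icc (0 : ℝ) 1)ᶜ = 0 := by
  refine withDensity_absolutelyContinuous _ _ ?_
  rw [Measure.restrict_apply measurableSet_Icc.compl, compl_inter_self, measure_empty]

theorem profileMeasure_absolutelyContinuous (u : ℝ → ℝ) : profileMeasure u ≪ volume :=
  (withDensity_absolutelyContinuous _ _).trans Measure.restrict_le_self.absolutelyContinuous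

theorem IsProfile.massOn (hu : IsProfile u) :
    MassOn (∫ r in Icc (0 : ℝ) 1, u r) (profileMeasure u) where
  nonneg := integral_nonneg_of_ae hu.2
  mass := by
    rw [← measure_add_measure_compl (measurableSet_Icc (a := (0 : ℝ)) (b := 1)),
      profileMeasure_compl, add_zero, hu.tail le_rfl]
  compl := profileMeasure_compl u
  one := profileMeasure_absolutelyContinuous u (measure_singleton 1)

theorem IsProfile.tail_eq_integral (hu : IsProfile u) {r : ℝ} (hr : r ∈ Icc (0 : ℝ) 1) :
    deviation (profileMeasure u) r + (∫ r in Icc (0 : ℝ) 1, u r) * (1 - r) =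
      ∫ x in Icc r 1, u x := by
  rw [hu.massOn.deviation_eq hr, sub_add_cancel, Measure.real, hu.tail hr.1,
    ENNReal.toReal_ofReal]
  exact integral_nonneg_of_ae
    (ae_restrict_of_ae_restrict_of_subset (Icc_subset_Icc_left hr.1) hu.2)

/-- A bounded density gives a Lipschitz deviation. -/
theorem IsProfile.exists_lipschitz (hu : IsProfile u) :
    ∃ L, ∀ y y', |deviation (profileMeasure u) y - deviation (profileMeasure u) y'| ≤
      L * |y - y'| := by
  obtain ⟨B, hB⟩ : ∃ B : ℝ, ∀ᵐ x ∂(volume.restrict (Icc (0 : ℝ) 1)), u x ≤ B := by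
    refine ⟨(eLpNormEssSup u (volume.restrict (Icc (0 : ℝ) 1))).toReal, ?_⟩
    have hfin : eLpNormEssSup u (volume.restrict (Icc (0 : ℝ) 1)) ≠ ∞ := by
      have := hu.1.2.ne
      rwa [eLpNorm_exponent_top] at this
    filter_upwards [enorm_ae_le_eLpNormEssSup u (volume.restrict (Icc (0 : ℝ) 1))] with x hx
    have := ENNReal.toReal_mono hfin hx
    rw [toReal_enorm] at this
    exact (le_abs_self _).trans this
  have hs := hu.massOn.state
  set M := ∫ r in Icc (0 : ℝ) 1, u r
  set D := deviation (profileMeasure u) with hD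
  have hM := hs.mass_nonneg
  -- the tail function falls at rate at most `B`
  have hdown : ∀ y y', y ≤ y' → -D y' - -D y ≤ B * (y' - y) := fun y y' hyy => by
    refine hs.toOddPer.neg.slope_of_Icc (fun y hy y' hy' hle => ?_) hyy
    have e1 := hu.tail_eq_integral hy
    have e2 := hu.tail_eq_integral hy'
    have hsub : Icc y y' ⊆ Icc (0 : ℝ) 1 := Icc_subset_Icc hy.1 hy'.2
    have e3 : ∫ x in Icc y 1, u x = (∫ x in Icc y y', u x) + ∫ x in Icc y' 1, u x := by
      have hint := hu.integrableOn
      rw [integral_Icc_eq_integral_Ioc, integral_Icc_eq_integral_Ioc, integral_Icc_eq_integral_Ioc,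
        ← intervalIntegral.integral_of_le hy.2, ← intervalIntegral.integral_of_le hle,
        ← intervalIntegral.integral_of_le hy'.2]
      refine (intervalIntegral.integral_add_adjacent_intervals ?_ ?_).symm
      · rw [intervalIntegrable_iff_integrableOn_Icc_of_le hle]
        exact hint.mono_set hsub
      · rw [intervalIntegrable_iff_integrableOn_Icc_of_le hy'.2]
        exact hint.mono_set (Icc_subset_Icc_left hy'.1)
    have e4 : ∫ x in Icc y y', u x ≤ B * (y' - y) := by
      calc ∫ x in Icc y y', u x ≤ ∫ _ in Icc y y', B :=
            integral_mono_ae (hu.integrableOn.mono_set hsub) (integrable_const _)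
              (ae_restrict_of_ae_restrict_of_subset hsub hB)
        _ = B * (y' - y) := by
            rw [integral_const, measureReal_restrict_apply_univ, Real.volume_real_Icc_of_le hle,
              smul_eq_mul, mul_comm]
    have e5 : M * (1 - y') ≤ M * (1 - y) := mul_le_mul_of_nonneg_left (by linarith) hM
    linarith
  refine ⟨max M B, fun y y' => ?_⟩
  have aux : ∀ y y', y ≤ y' → |D y - D y'| ≤ max M B * |y - y'| := fun y y' h => by
    have h1 := hs.slope y y' h
    have h2 := hdown y y' h
    have h3 : M * (y' - y) ≤ max M B * (y' - y) :=
      mul_le_mul_of_nonneg_right (le_max_left _ _) (by linarith)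
    have h4 : B * (y' - y) ≤ max M B * (y' - y) :=
      mul_le_mul_of_nonneg_right (le_max_right _ _) (by linarith)
    rw [abs_sub_comm y y', abs_of_nonneg (sub_nonneg.2 h), abs_le]
    constructor <;> linarith
  rcases le_total y y' with h | h
  · exact aux y y' h
  · rw [abs_sub_comm, abs_sub_comm y y']
    exact aux y' y h

theorem IsProfile.massOn_lowerBarrier (hu : IsProfile u) (hj : 0 < j) (hδ : 0 < δ)
    (hlt : j * δ < ∫ r in Icc (0 : ℝ) 1, u r) (n : ℕ) :
    MassOn (∫ r in Icc (0 : ℝ) 1, u r) (lowerBarrier j δ u n) ∧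
      deviation (lowerBarrier j δ u n) =
        (lowStep (∫ r in Icc (0 : ℝ) 1, u r) j δ)^[n] (deviation (profileMeasure u)) := by
  induction n with
  | zero => exact ⟨hu.massOn, rfl⟩
  | succ n ih =>
    obtain ⟨h1, h2⟩ := ih.1.heat hδ
    obtain ⟨h3, h4⟩ := h1.cutPaste (neumannHeat_absolutelyContinuous δ _) (mul_pos hj hδ) hlt
    refine ⟨h3, ?_⟩
    rw [Function.iterate_succ_apply', ← ih.2, lowStep, ← h2]
    exact h4

/-- Absolute continuity is carried along because the next cut needs a measure without atoms. -/
theorem IsProfile.massOn_upperBarrier (hu : IsProfile u) (hj : 0 < j) (hδ : 0 < δ)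
    (hlt : j * δ < ∫ r in Icc (0 : ℝ) 1, u r) (n : ℕ) :
    (MassOn (∫ r in Icc (0 : ℝ) 1, u r) (upperBarrier j δ u n) ∧
      deviation (upperBarrier j δ u n) =
        (upStep (∫ r in Icc (0 : ℝ) 1, u r) j δ)^[n] (deviation (profileMeasure u))) ∧
      upperBarrier j δ u n ≪ volume := by
  induction n with
  | zero => exact ⟨⟨hu.massOn, rfl⟩, profileMeasure_absolutelyContinuous u⟩
  | succ n ih =>
    obtain ⟨h1, h2⟩ := ih.1.1.cutPaste ih.2 (mul_pos hj hδ) hlt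
    obtain ⟨h3, h4⟩ := h1.heat hδ
    refine ⟨⟨h3, ?_⟩, neumannHeat_absolutelyContinuous δ _⟩
    rw [Function.iterate_succ_apply', ← ih.1.2, upStep, ← h2]
    exact h4

theorem ofReal_lt_tailMass_iff (hu : IsProfile u) (hpos : 0 ≤ j * δ) :
    ENNReal.ofReal (j * δ) < tailMass 0 (profileMeasure u) ↔
      j * δ < ∫ r in Icc (0 : ℝ) 1, u r := by
  rw [tailMass, hu.tail le_rfl]
  exact ENNReal.ofReal_lt_ofReal_iff_of_nonneg hpos

theorem transportLE_iff (h : MassOn M μ) (h' : MassOn M ν) :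
    TransportLE μ ν ↔ ∀ y ∈ Icc (0 : ℝ) 1, deviation μ y ≤ deviation ν y := by
  refine forall₂_congr fun y hy => ?_
  rw [tailMass, tailMass, h.tail_eq hy, h'.tail_eq hy,
    ENNReal.ofReal_le_ofReal_iff (h'.state.tail_nonneg hy.2)]
  constructor <;> intro h <;> linarith

theorem IsProfile.ae_eq_of_tail (hu : IsProfile u) (hv : IsProfile v)
    (h : ∀ r ∈ Icc (0 : ℝ) 1, profileMeasure u (Icc r 1) = profileMeasure v (Icc r 1)) :
    ∀ᵐ r ∂(volume.restrict (Icc (0 : ℝ) 1)), u r = v r := by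
  have hfin := hu.massOn.finite
  have hIci : ∀ (w : ℝ → ℝ) (a : ℝ), profileMeasure w (Ici a) = profileMeasure w (Icc a 1) :=
    fun w a => by
    refine le_antisymm ?_ (measure_mono Icc_subset_Ici_self)
    calc _ ≤ profileMeasure w (Icc a 1 ∪ (Icc (0 : ℝ) 1)ᶜ) := by
          refine measure_mono fun x hx => ?_
          by_cases h1 : x ∈ Icc (0 : ℝ) 1
          · exact Or.inl ⟨hx, h1.2⟩
          · exact Or.inr h1
      _ ≤ _ := by
          refine (measure_union_le _ _).trans_eq ?_
          rw [profileMeasure_compl, add_zero]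
  have hneg : ∀ (w : ℝ → ℝ) (a : ℝ), a ≤ 0 → profileMeasure w (Ici a) = profileMeasure w (Icc 0 1) :=
    fun w a ha => by
    refine le_antisymm ?_ (measure_mono fun x hx => ha.trans hx.1)
    refine (measure_mono (subset_univ _)).trans ?_
    rw [← measure_add_measure_compl (measurableSet_Icc (a := (0 : ℝ)) (b := 1)),
      profileMeasure_compl, add_zero]
  have heq : profileMeasure u = profileMeasure v := by
    refine Measure.ext_of_Ici _ _ fun a => ?_
    rcases le_total a 0 with ha | ha
    · rw [hneg u a ha, hneg v a ha, h 0 ⟨le_rfl, zero_le_one⟩]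
    · rcases le_or_gt a 1 with ha1 | ha1
      · rw [hIci, hIci, h a ⟨ha, ha1⟩]
      · rw [hIci, hIci, Icc_eq_empty (not_le.2 ha1), measure_empty, measure_empty]
  have h1 := (withDensity_eq_iff hu.1.1.aemeasurable.ennreal_ofReal
    hv.1.1.aemeasurable.ennreal_ofReal (by
      have := hfin.measure_univ_lt_top.ne
      rwa [profileMeasure, withDensity_apply _ MeasurableSet.univ, Measure.restrict_univ] at this)).1
    heq
  filter_upwards [h1, hu.2, hv.2] with r hr hur hvr
  exact (ENNReal.ofReal_eq_ofReal_iff hur hvr).1 hr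

end Profile

section Solution

variable {u v : ℝ → ℝ}

/-- A separating function has the tails prescribed by `evolve`: at a positive time `t` the steps
`t / (n + 1)` are admissible for large `n` and squeeze it. -/
theorem Separates.tail (hu : IsProfile u) (hj : 0 < j) (hmass : 0 < ∫ r in Icc (0 : ℝ) 1, u r)
    {v : ℝ → ℝ → ℝ} (hv : Separates j u v) {t : ℝ} (ht : 0 ≤ t) {r : ℝ} (hr : r ∈ Icc (0 : ℝ) 1) :
    profileMeasure (fun r => v r t) (Icc r 1) =
      ENNReal.ofReal (evolve (∫ r in Icc (0 : ℝ) 1, u r) j t (deviation (profileMeasure u)) r +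
        (∫ r in Icc (0 : ℝ) 1, u r) * (1 - r)) := by
  have hs := hu.massOn.state
  set M := ∫ r in Icc (0 : ℝ) 1, u r with hM
  set D := deviation (profileMeasure u) with hD
  have hsand : ∀ δ : ℝ, 0 < δ → j * δ < M → ∀ k : ℕ,
      ENNReal.ofReal ((lowStep M j δ)^[k] D r + M * (1 - r)) ≤
        profileMeasure (fun r => v r (k * δ)) (Icc r 1) ∧
      profileMeasure (fun r => v r (k * δ)) (Icc r 1) ≤
        ENNReal.ofReal ((upStep M j δ)^[k] D r + M * (1 - r)) := by
    intro δ hδ hlt k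
    obtain ⟨h1, h2⟩ := hv.2 δ hδ ((ofReal_lt_tailMass_iff hu (mul_pos hj hδ).le).2 hlt) k
    have l := hu.massOn_lowerBarrier hj hδ hlt k
    have p := (hu.massOn_upperBarrier hj hδ hlt k).1
    have h1 := h1 r hr
    have h2 := h2 r hr
    rw [tailMass, l.1.tail_eq hr, l.2] at h1
    rw [tailMass, tailMass, p.1.tail_eq hr, p.2] at h2
    exact ⟨h1, h2⟩
  rcases ht.eq_or_lt with rfl | ht
  -- at time `0` any admissible step will do
  · obtain ⟨h1, h2⟩ := hsand (M / (2 * j)) (by positivity) (by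
      rw [mul_div_assoc', div_lt_iff₀ (by positivity)]; nlinarith) 0
    simp only [Nat.cast_zero, zero_mul, Function.iterate_zero, id] at h1 h2
    rw [evolve_zero]
    exact le_antisymm h2 h1
  · have hev : ∀ᶠ n : ℕ in atTop, j * (t / ((n : ℝ) + 1)) < M := by
      have := (tendsto_mul_one_div_add_atTop (j * t)).eventually (gt_mem_nhds hmass)
      filter_upwards [this] with n hn
      refine lt_of_eq_of_lt ?_ hn
      ring
    have hk : ∀ n : ℕ, ((n + 1 : ℕ) : ℝ) * (t / ((n : ℝ) + 1)) = t := fun n => by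
      push_cast
      field_simp
    have hup := ENNReal.tendsto_ofReal ((tendsto_unifUp hs hj.le ht r).add_const (M * (1 - r)))
    have hlow := ENNReal.tendsto_ofReal ((tendsto_unifLow hs hj.le ht r).add_const (M * (1 - r)))
    refine le_antisymm (ge_of_tendsto hup ?_) (le_of_tendsto hlow ?_)
    · filter_upwards [hev] with n hn
      have := (hsand (t / (n + 1)) (by positivity) hn (n + 1)).2
      rwa [hk] at this
    · filter_upwards [hev] with n hn
      have := (hsand (t / (n + 1)) (by positivity) hn (n + 1)).1
      rwa [hk] at this

/-- The separating function: minus the spatial derivative of the tail function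
`r ↦ evolve M j t D r + M * (1 - r)` at positive times, and `u` itself at time `0`. -/
def solution (j : ℝ) (u : ℝ → ℝ) (r t : ℝ) : ℝ :=
  if 0 < t then (∫ r in Icc (0 : ℝ) 1, u r) -
    deriv (evolve (∫ r in Icc (0 : ℝ) 1, u r) j t (deviation (profileMeasure u))) r
  else u r

theorem continuousOn_solution (hu : IsProfile u) (hj : 0 ≤ j) :
    ContinuousOn (fun p : ℝ × ℝ => solution j u p.1 p.2) (univ ×ˢ Ioi (0 : ℝ)) := by
  obtain ⟨L, hL⟩ := hu.exists_lipschitz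
  refine ((continuousOn_const (c := ∫ r in Icc (0 : ℝ) 1, u r)).sub
    (continuousOn_deriv_evolve hu.massOn.state hL hj)).congr fun p hp => ?_
  have : 0 < p.2 := hp.2
  simp only [solution, if_pos this, Pi.sub_apply]

theorem continuous_solution (hu : IsProfile u) (hj : 0 ≤ j) {t : ℝ} (ht : 0 < t) :
    Continuous fun r => solution j u r t := by
  have h : Continuous fun r : ℝ => (r, t) := by fun_prop
  exact (continuousOn_solution hu hj).comp_continuous h fun r => ⟨mem_univ _, ht⟩

theorem isProfile_solution (hu : IsProfile u) (hj : 0 ≤ j) {t : ℝ} (ht : 0 ≤ t) :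
    IsProfile fun r => solution j u r t := by
  rcases ht.eq_or_lt with rfl | ht
  · simpa [solution] using hu
  have hc := continuous_solution hu hj ht
  refine ⟨?_, ae_of_all _ fun r => ?_⟩
  · obtain ⟨B, hB⟩ := isCompact_Icc.exists_bound_of_continuousOn (hc.continuousOn (s := Icc 0 1))
    refine memLp_top_of_bound hc.aestronglyMeasurable B ?_
    exact ae_restrict_of_forall_mem measurableSet_Icc hB
  · simp only [solution, if_pos ht]
    have := deriv_evolve_le hu.massOn.state hj ht r
    linarith

theorem integral_solution (hu : IsProfile u) (hj : 0 ≤ j) {t : ℝ} (ht : 0 ≤ t) {r : ℝ}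
    (hr : r ∈ Icc (0 : ℝ) 1) : ∫ x in Icc r 1, solution j u x t =
      evolve (∫ r in Icc (0 : ℝ) 1, u r) j t (deviation (profileMeasure u)) r +
        (∫ r in Icc (0 : ℝ) 1, u r) * (1 - r) := by
  rcases ht.eq_or_lt with rfl | ht
  · rw [evolve_zero, hu.tail_eq_integral hr]
    simp [solution]
  have hs := hu.massOn.state
  set M := ∫ r in Icc (0 : ℝ) 1, u r with hM
  set D := deviation (profileMeasure u) with hD
  rw [integral_Icc_eq_integral_Ioc, ← intervalIntegral.integral_of_le hr.2]
  have hder : ∀ x ∈ uIcc r 1, HasDerivAt (fun x => M * x - evolve M j t D x)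
      (solution j u x t) x := fun x _ => by
    have h1 := ((hasDerivAt_id x).const_mul M).sub (differentiableAt_evolve hs hj ht x).hasDerivAt
    rw [mul_one] at h1
    rw [solution, if_pos ht]
    exact h1
  rw [intervalIntegral.integral_eq_sub_of_hasDerivAt hder
    ((continuous_solution hu hj ht).intervalIntegrable _ _), (hs.evolve hj ht.le).one]
  ring

theorem solution_massOn (hu : IsProfile u) (hj : 0 ≤ j) {t : ℝ} (ht : 0 ≤ t) :
    MassOn (∫ r in Icc (0 : ℝ) 1, u r) (profileMeasure fun r => solution j u r t) ∧
      deviation (profileMeasure fun r => solution j u r t) =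
        evolve (∫ r in Icc (0 : ℝ) 1, u r) j t (deviation (profileMeasure u)) :=
  MassOn.of_tail (hu.massOn.state.evolve hj ht) (profileMeasure_compl _) fun r hr => by
    rw [(isProfile_solution hu hj ht).tail hr.1, integral_solution hu hj ht hr]

theorem separates_solution (hu : IsProfile u) (hj : 0 < j) : Separates j u (solution j u) := by
  refine ⟨fun t ht => isProfile_solution hu hj.le ht, fun δ hδ hlt k => ?_⟩
  rw [ofReal_lt_tailMass_iff hu (mul_pos hj hδ).le] at hlt
  have l := hu.massOn_lowerBarrier hj hδ hlt k
  have p := (hu.massOn_upperBarrier hj hδ hlt k).1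
  have s := solution_massOn hu hj.le (t := k * δ) (by positivity)
  rw [transportLE_iff l.1 s.1, transportLE_iff s.1 p.1, l.2, p.2, s.2]
  exact ⟨lowIter_le_evolve hu.massOn.state hj.le hδ k, evolve_le_upIter hu.massOn.state hj.le hδ k⟩

end Solution

section WeakConvergence

/-- Integrals against a density in terms of its tails, by Fubini. -/
theorem integral_mul_eq_tail {p p' w : ℝ → ℝ} (hp : ∀ x, HasDerivAt p (p' x) x)
    (hp' : Continuous p') (hw : IntegrableOn w (Icc 0 1)) :
    ∫ x in Icc (0 : ℝ) 1, p x * w x = p 0 * (∫ x in Icc (0 : ℝ) 1, w x) +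
      ∫ r in Icc (0 : ℝ) 1, p' r * ∫ x in Icc r 1, w x := by
  set ν := volume.restrict (Icc (0 : ℝ) 1) with hν
  have hp'i : Integrable p' ν := hp'.continuousOn.integrableOn_compact isCompact_Icc
  have hT : MeasurableSet {q : ℝ × ℝ | q.2 ≤ q.1} := measurableSet_le measurable_snd measurable_fst
  have hint : Integrable ({q : ℝ × ℝ | q.2 ≤ q.1}.indicator fun q => w q.1 * p' q.2) (ν.prod ν) :=
    (Integrable.mul_prod hw hp'i).indicator hT
  have e1 : ∀ x ∈ Icc (0 : ℝ) 1, ∫ r, {q : ℝ × ℝ | q.2 ≤ q.1}.indicator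
      (fun q => w q.1 * p' q.2) (x, r) ∂ν = (p x - p 0) * w x := by
    intro x hx
    have a1 : (fun r => {q : ℝ × ℝ | q.2 ≤ q.1}.indicator (fun q => w q.1 * p' q.2) (x, r)) =
        (Iic x).indicator fun r => w x * p' r := by
      funext r
      simp only [indicator, mem_ofPred_eq, mem_Iic]
    have a2 : Iic x ∩ Icc (0 : ℝ) 1 = Icc 0 x := by
      ext r
      simp only [mem_inter_iff, mem_Iic, mem_Icc]
      exact ⟨fun h => ⟨h.2.1, h.1⟩, fun h => ⟨h.2, h.1, h.2.trans hx.2⟩⟩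
    rw [a1, integral_indicator measurableSet_Iic, hν, Measure.restrict_restrict measurableSet_Iic,
      a2, integral_const_mul, integral_Icc_eq_integral_Ioc, ← intervalIntegral.integral_of_le hx.1,
      intervalIntegral.integral_eq_sub_of_hasDerivAt (fun y _ => hp y)
        (hp'.intervalIntegrable _ _), mul_comm]
  have e2 : ∀ r ∈ Icc (0 : ℝ) 1, ∫ x, {q : ℝ × ℝ | q.2 ≤ q.1}.indicator
      (fun q => w q.1 * p' q.2) (x, r) ∂ν = p' r * ∫ x in Icc r 1, w x := by
    intro r hr
    have a1 : (fun x => {q : ℝ × ℝ | q.2 ≤ q.1}.indicator (fun q => w q.1 * p' q.2) (x, r)) =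
        (Ici r).indicator fun x => w x * p' r := by
      funext x
      simp only [indicator, mem_ofPred_eq, mem_Ici]
    have a2 : Ici r ∩ Icc (0 : ℝ) 1 = Icc r 1 := by
      ext x
      simp only [mem_inter_iff, mem_Ici, mem_Icc]
      exact ⟨fun h => ⟨h.1, h.2.2⟩, fun h => ⟨h.1, hr.1.trans h.1, h.2⟩⟩
    rw [a1, integral_indicator measurableSet_Ici, hν, Measure.restrict_restrict measurableSet_Ici,
      a2, integral_mul_const, mul_comm]
  have hsw := integral_integral_swap (f := fun x r => {q : ℝ × ℝ | q.2 ≤ q.1}.indicator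
      (fun q => w q.1 * p' q.2) (x, r)) hint
  rw [setIntegral_congr_fun measurableSet_Icc e1, setIntegral_congr_fun measurableSet_Icc e2] at hsw
  have hpc : ContinuousOn p (Icc 0 1) := fun x _ => (hp x).continuousAt.continuousWithinAt
  have hpw : Integrable (fun x => p x * w x) ν := hw.continuousOn_mul hpc isCompact_Icc
  rw [← hsw]
  simp only [sub_mul]
  rw [integral_sub hpw (hw.const_mul (p 0)), integral_const_mul]
  ring

theorem abs_integral_mul_sub_le {φ p w : ℝ → ℝ} {ε : ℝ} (hφ : ContinuousOn φ (Icc 0 1))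
    (hp : ContinuousOn p (Icc 0 1)) (hw : IsProfile w) (h : ∀ x ∈ Icc (0 : ℝ) 1, |p x - φ x| ≤ ε) :
    |(∫ x in Icc (0 : ℝ) 1, p x * w x) - ∫ x in Icc (0 : ℝ) 1, φ x * w x| ≤
      ε * ∫ x in Icc (0 : ℝ) 1, w x := by
  have hi := hw.integrableOn
  rw [← integral_sub (hi.continuousOn_mul hp isCompact_Icc) (hi.continuousOn_mul hφ isCompact_Icc),
    ← integral_const_mul]
  rw [← Real.norm_eq_abs]
  refine norm_integral_le_of_norm_le (hi.const_mul ε) ?_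
  filter_upwards [ae_restrict_mem measurableSet_Icc, hw.2] with x hx hwx
  rw [← sub_mul, norm_mul, Real.norm_eq_abs, Real.norm_eq_abs, abs_of_nonneg hwx]
  exact mul_le_mul_of_nonneg_right (h x hx) hwx

variable {u : ℝ → ℝ}

/-- Weak convergence to the initial profile: the tails converge uniformly, which gives the limit for
polynomial test functions, and these are dense. -/
theorem tendsto_integral_solution (hu : IsProfile u) (hj : 0 ≤ j)
    {φ : ℝ → ℝ} (hφ : ContinuousOn φ (Icc 0 1)) :
    Tendsto (fun t : ℝ => ∫ r in Icc (0 : ℝ) 1, φ r * solution j u r t) (𝓝[>] 0)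
      (𝓝 (∫ r in Icc (0 : ℝ) 1, φ r * u r)) := by
  have hs := hu.massOn.state
  obtain ⟨L, hL⟩ := hu.exists_lipschitz
  set M := ∫ r in Icc (0 : ℝ) 1, u r with hM
  set D := deviation (profileMeasure u) with hD
  have hM0 : 0 ≤ M := hs.mass_nonneg
  rw [Metric.tendsto_nhds]
  intro ε hε
  set η := ε / (4 * (M + 1)) with hη
  have hη0 : 0 < η := by positivity
  obtain ⟨p, hp⟩ := exists_polynomial_near_of_continuousOn 0 1 φ hφ η hη0
  have hpc : Continuous fun x => p.eval x := p.continuous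
  have hpc' : Continuous fun x => p.derivative.eval x := p.derivative.continuous
  obtain ⟨C, hC⟩ := isCompact_Icc.exists_bound_of_continuousOn (hpc'.continuousOn (s := Icc 0 1))
  have hpd : ∀ x, HasDerivAt (fun x => p.eval x) (p.derivative.eval x) x := fun x => p.hasDerivAt x
  have hC0 : 0 ≤ C := (norm_nonneg _).trans (hC 0 ⟨le_rfl, zero_le_one⟩)
  have hsmall : Tendsto (fun t : ℝ => C * (j * t + (L + 2 * j * √0) * √t)) (𝓝[>] 0) (𝓝 0) := by
    have : Continuous fun t : ℝ => C * (j * t + (L + 2 * j * √0) * √t) := by fun_prop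
    simpa using (this.tendsto 0).mono_left nhdsWithin_le_nhds
  filter_upwards [self_mem_nhdsWithin, hsmall.eventually (gt_mem_nhds (half_pos hε))] with t ht hts
  rw [mem_Ioi] at ht
  have hprof := isProfile_solution hu hj ht.le
  have hmassT : ∫ x in Icc (0 : ℝ) 1, solution j u x t = M := by
    rw [integral_solution hu hj ht.le ⟨le_rfl, zero_le_one⟩, (hs.evolve hj ht.le).zero]
    simpa using hM.symm
  have h1 : |(∫ x in Icc (0 : ℝ) 1, p.eval x * solution j u x t) -
      ∫ x in Icc (0 : ℝ) 1, φ x * solution j u x t| ≤ η * M := by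
    rw [← hmassT]
    exact abs_integral_mul_sub_le hφ hpc.continuousOn hprof fun x hx => (hp x hx).le
  have h2 : |(∫ x in Icc (0 : ℝ) 1, p.eval x * u x) - ∫ x in Icc (0 : ℝ) 1, φ x * u x| ≤ η * M :=
    abs_integral_mul_sub_le hφ hpc.continuousOn hu fun x hx => (hp x hx).le
  have h3 : |(∫ x in Icc (0 : ℝ) 1, p.eval x * solution j u x t) -
      ∫ x in Icc (0 : ℝ) 1, p.eval x * u x| ≤ C * (j * t + (L + 2 * j * √0) * √t) := by
    rw [integral_mul_eq_tail hpd hpc' hprof.integrableOn,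
      integral_mul_eq_tail hpd hpc' hu.integrableOn, hmassT, add_sub_add_left_eq_sub]
    have g1 : ∫ r in Icc (0 : ℝ) 1, p.derivative.eval r * ∫ x in Icc r 1, solution j u x t =
        ∫ r in Icc (0 : ℝ) 1, p.derivative.eval r * (evolve M j t D r + M * (1 - r)) :=
      setIntegral_congr_fun measurableSet_Icc fun r hr => by
        simp only [integral_solution hu hj ht.le hr, hM, hD]
    have g2 : ∫ r in Icc (0 : ℝ) 1, p.derivative.eval r * ∫ x in Icc r 1, u x =
        ∫ r in Icc (0 : ℝ) 1, p.derivative.eval r * (D r + M * (1 - r)) :=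
      setIntegral_congr_fun measurableSet_Icc fun r hr => by
        simp only [← hu.tail_eq_integral hr, hM, hD]
    have hcont : ∀ {E : ℝ → ℝ} {K : ℝ}, (∀ y y', |E y - E y'| ≤ K * |y - y'|) →
        IntegrableOn (fun r => p.derivative.eval r * (E r + M * (1 - r))) (Icc (0 : ℝ) 1) := by
      intro E K hK
      have hE : Continuous E := (LipschitzWith.of_dist_le' hK).continuous
      exact Continuous.integrableOn_Icc (by fun_prop)
    rw [g1, g2, ← integral_sub (hcont (evolve_lipschitz hs hL hj ht.le)) (hcont hL)]
    have := norm_setIntegral_le_of_norm_le_const (μ := volume) (s := Icc (0 : ℝ) 1)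
      (f := fun r => p.derivative.eval r * (evolve M j t D r + M * (1 - r)) -
        p.derivative.eval r * (D r + M * (1 - r)))
      (C := C * (j * t + (L + 2 * j * √0) * √t)) (by simp) fun r hr => by
        rw [← mul_sub, add_sub_add_right_eq_sub, norm_mul]
        refine mul_le_mul (hC r hr) ?_ (norm_nonneg _) hC0
        have := abs_evolve_add_sub_le hs hL hj le_rfl ht.le r
        rwa [zero_add, evolve_zero] at this
    simpa using this
  have h4 : η * M < ε / 4 := by
    rw [hη, div_mul_eq_mul_div, div_lt_div_iff₀ (by positivity) (by norm_num)]
    nlinarith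
  rw [Real.dist_eq]
  rw [abs_sub_comm] at h1
  refine (abs_sub_le _ (∫ x in Icc (0 : ℝ) 1, p.eval x * solution j u x t) _).trans_lt ?_
  have h5 := abs_sub_le (∫ x in Icc (0 : ℝ) 1, p.eval x * solution j u x t)
    (∫ x in Icc (0 : ℝ) 1, p.eval x * u x) (∫ x in Icc (0 : ℝ) 1, φ x * u x)
  have h6 := add_lt_add_of_le_of_lt (add_le_add h1 h3) (h2.trans_lt h4)
  linarith

end WeakConvergence

end Profiles

end CutPaste

end

theorem theorem2p3 (j : ℝ) (hj : 0 < j) (u : ℝ → ℝ) (hu : CutPaste.IsProfile u)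
    (hmass : 0 < ∫ r in Icc (0 : ℝ) 1, u r) :
    ∃ ψ : ℝ → ℝ → ℝ,
      CutPaste.Separates j u ψ ∧
      (∀ v : ℝ → ℝ → ℝ, CutPaste.Separates j u v →
        ∀ t : ℝ, 0 ≤ t →
          ∀ᵐ r ∂(volume.restrict (Icc (0 : ℝ) 1)), v r t = ψ r t) ∧
      (∀ v : ℝ → ℝ → ℝ, CutPaste.Separates j u v →
        ContinuousOn (fun p : ℝ × ℝ => v p.1 p.2) (Icc (0 : ℝ) 1 ×ˢ Ioi (0 : ℝ)) →
        ∀ r ∈ Icc (0 : ℝ) 1, ∀ t : ℝ, 0 < t → v r t = ψ r t) ∧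
      ContinuousOn (fun p : ℝ × ℝ => ψ p.1 p.2) (Icc (0 : ℝ) 1 ×ˢ Ioi (0 : ℝ)) ∧
      (∀ φ : ℝ → ℝ, ContinuousOn φ (Icc (0 : ℝ) 1) →
        Tendsto (fun t : ℝ => ∫ r in Icc (0 : ℝ) 1, φ r * ψ r t) (𝓝[>] 0)
          (𝓝 (∫ r in Icc (0 : ℝ) 1, φ r * u r))) := by
  have hsep := CutPaste.separates_solution hu hj
  have huniq : ∀ v : ℝ → ℝ → ℝ, CutPaste.Separates j u v → ∀ t : ℝ, 0 ≤ t →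
      ∀ᵐ r ∂(volume.restrict (Icc (0 : ℝ) 1)), v r t = CutPaste.solution j u r t :=
    fun v hv t ht => (hv.1 t ht).ae_eq_of_tail (hsep.1 t ht) fun r hr => by
      rw [hv.tail hu hj hmass ht hr, hsep.tail hu hj hmass ht hr]
  refine ⟨CutPaste.solution j u, hsep, huniq, fun v hv hc r hr t ht => ?_,
    (CutPaste.continuousOn_solution hu hj.le).mono (prod_mono (subset_univ _) subset_rfl),
    fun φ hφ => CutPaste.tendsto_integral_solution hu hj.le hφ⟩
  have hslice : Continuous fun r : ℝ => (r, t) := by fun_prop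
  have hvt : ContinuousOn (fun r => v r t) (Icc (0 : ℝ) 1) :=
    hc.comp (f := fun r : ℝ => (r, t)) hslice.continuousOn fun r hr => ⟨hr, ht⟩
  exact Measure.eqOn_Icc_of_ae_eq volume zero_ne_one (huniq v hv t ht.le) hvt
    (CutPaste.continuous_solution hu hj.le ht).continuousOn hr
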